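/- Let $n\ge 1$ and let $D=\Omega+i\,\mathbb{R}^{n+1}\subset\mathbb{C}^{n+1}$ be a tube domain (open and connected) whose base $\Omega\subset\mathbb{R}^{n+1}$ is affinely homogeneous, i.e. the group $\operatorname{Aff}(\Omega)$ of all invertible affine transformations $g$ of $\mathbb{R}^{n+1}$ with $g(\Omega)=\Omega$ acts transitively on $\Omega$. Let $\partial^{\mathrm{def}}\Omega$ be the part of the boundary of $\Omega$ with definite second fundamental form, i.e. the set of those $p\in\partial\Omega$ near which $\partial\Omega$ is a $C^2$ hypersurface whose second fundamental form at $p$ is positive or negative definite. Suppose that $\operatorname{Aff}(\Omega)$ acts locally transitively on $\partial^{\mathrm{def}}\Omega\neq\emptyset$, or merely on some nonempty subset $\Gamma\subset\partial^{\mathrm{def}}\Omega$ that is relatively open in $\partial\Omega$: for every $p\in\Gamma$ all points of $\Gamma$ sufficiently close to $p$ lie in the orbit $\operatorname{Aff}(\Omega)\,p$. Then $\partial^{\mathrm{def}}\Omega$ is affinely equivalent to the paraboloid \[ x_{n+1}=\sum_{i=1}^n x_i^2, \] i.e. there is an invertible affine transformation $f$ of $\mathbb{R}^{n+1}$ which maps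 $\partial^{\mathrm{def}}\Omega$ onto this paraboloid. -/

import Mathlib

open Set Filter Topology

/-- The vector of real parts of a vector of `ℂ^m`. -/
noncomputable def vecRe {m : ℕ} (z : EuclideanSpace ℂ (Fin m)) : EuclideanSpace ℝ (Fin m) :=
  WithLp.toLp 2 (fun i => (z i).re)

/-- The tube `Ω + i ℝ^m` in `ℂ^m` with base `Ω ⊆ ℝ^m`. -/
def tube {m : ℕ} (Ω : Set (EuclideanSpace ℝ (Fin m))) : Set (EuclideanSpace ℂ (Fin m)) :=
  {z | vecRe z ∈ Ω}

/-- The group of affine symmetries of a set `Ω ⊆ ℝ^m`: all invertible affine transformations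
of `ℝ^m` that map `Ω` onto itself. -/
def affineSymmetryGroup {m : ℕ} (Ω : Set (EuclideanSpace ℝ (Fin m))) :
    Subgroup (EuclideanSpace ℝ (Fin m) ≃ᵃ[ℝ] EuclideanSpace ℝ (Fin m)) where
  carrier := {g | g '' Ω = Ω}
  mul_mem' := by
    intro a b ha hb
    simp only [mem_ofPred_eq] at ha hb ⊢
    rw [AffineEquiv.coe_mul, image_comp, hb, ha]
  one_mem' := by
    simp only [mem_ofPred_eq]
    rw [AffineEquiv.coe_one, image_id]
  inv_mem' := by
    intro a ha
    simp only [mem_ofPred_eq] at ha ⊢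
    conv_lhs => rw [← ha]
    rw [← image_comp, ← AffineEquiv.coe_mul, inv_mul_cancel, AffineEquiv.coe_one, image_id]

/-- `Ω` is affinely homogeneous: its affine symmetries act transitively on it. -/
def IsAffinelyHomogeneous {m : ℕ} (Ω : Set (EuclideanSpace ℝ (Fin m))) : Prop :=
  ∀ x ∈ Ω, ∀ y ∈ Ω, ∃ g ∈ affineSymmetryGroup Ω, g x = y

/-- The affine symmetries of `Ω` act locally transitively on `Γ`: the orbit of every point `p`
of `Γ` contains a neighbourhood of `p` in `Γ`. -/
def ActsLocallyTransitivelyOn {m : ℕ} (Ω Γ : Set (EuclideanSpace ℝ (Fin m))) : Prop :=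
  ∀ p ∈ Γ, ∀ᶠ q in 𝓝[Γ] p, ∃ g ∈ affineSymmetryGroup Ω, g p = q

/-- `ρ` is a `C²` local defining function of the set `S` at the point `p ∈ S`; the set `S` is a
`C²` hypersurface near `p` if and only if it has one. -/
def IsLocalDefiningFunction {m : ℕ} (S : Set (EuclideanSpace ℝ (Fin m)))
    (p : EuclideanSpace ℝ (Fin m)) (ρ : EuclideanSpace ℝ (Fin m) → ℝ) : Prop :=
  p ∈ S ∧ ContDiffAt ℝ 2 ρ p ∧ fderiv ℝ ρ p ≠ 0 ∧ ∀ᶠ x in 𝓝 p, (x ∈ S ↔ ρ x = 0)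

/-- The tangent hyperplane at `p` of the hypersurface `ρ = 0`. -/
noncomputable def tangentHyperplane {m : ℕ} (ρ : EuclideanSpace ℝ (Fin m) → ℝ)
    (p : EuclideanSpace ℝ (Fin m)) : Submodule ℝ (EuclideanSpace ℝ (Fin m)) :=
  LinearMap.ker (fderiv ℝ ρ p : EuclideanSpace ℝ (Fin m) →ₗ[ℝ] ℝ)

/-- The second fundamental form at `p` of the hypersurface `ρ = 0` with respect to the unit
normal `∇ρ / ‖∇ρ‖`, evaluated on tangent vectors `v`, `w`. -/
noncomputable def secondFundamentalForm {m : ℕ} (ρ : EuclideanSpace ℝ (Fin m) → ℝ)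
    (p v w : EuclideanSpace ℝ (Fin m)) : ℝ :=
  -(fderiv ℝ (fderiv ℝ ρ) p v w) / ‖fderiv ℝ ρ p‖

/-- The second fundamental form at `p` of the hypersurface `ρ = 0` is (positive or negative)
definite on the tangent hyperplane. -/
def HasDefiniteSecondFundamentalForm {m : ℕ} (ρ : EuclideanSpace ℝ (Fin m) → ℝ)
    (p : EuclideanSpace ℝ (Fin m)) : Prop :=
  (∀ v ∈ tangentHyperplane ρ p, v ≠ 0 → 0 < secondFundamentalForm ρ p v v) ∨
  (∀ v ∈ tangentHyperplane ρ p, v ≠ 0 → secondFundamentalForm ρ p v v < 0)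

/-- The part of the boundary of `Ω` with definite second fundamental form: all boundary points
near which the boundary is a `C²` hypersurface and at which the second fundamental form of this
hypersurface is definite. -/
def definiteBoundaryPart {m : ℕ} (Ω : Set (EuclideanSpace ℝ (Fin m))) :
    Set (EuclideanSpace ℝ (Fin m)) :=
  {p | ∃ ρ : EuclideanSpace ℝ (Fin m) → ℝ,
    IsLocalDefiningFunction (frontier Ω) p ρ ∧ HasDefiniteSecondFundamentalForm ρ p}

/-- The paraboloid `x_{n+1} = x_1² + ⋯ + x_n²` in `ℝ^{n+1}`. -/
def paraboloid (n : ℕ) : Set (EuclideanSpace ℝ (Fin (n + 1))) :=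
  {x | x (Fin.last n) = ∑ i : Fin n, x i.castSucc ^ 2}

/-! Let `G` be the group of affine symmetries of `Ω`, realized as a closed subgroup of
`GL(ℝ × ℝ^{n+1})`, and let `𝔤` be its Lie algebra. Since `G` is transitive on the open set `Ω`, a
Baire category argument shows that `𝔤` evaluates onto the whole tangent space at every point
`x ∈ Ω`, whereas at a point of the definite boundary, taken to be `0`, it only takes values in the
tangent hyperplane. Counting dimensions, for every `x ∈ Ω` some element of `𝔤` vanishes at `0` but
not at `x`; it generates a linear one-parameter group preserving the boundary.

In coordinates `(x, y)` in which the boundary is `y = ‖x‖² + o(‖x‖² + |y|)`, blowing up by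
`(x, y) ↦ (s x, s² y)` shows that each linear symmetry acts on the tangent hyperplane as a
similarity whose squared ratio `χ` is its transversal factor. If `χ ≠ 1` for some symmetry, a shear
turns it into a quasi-homogeneous contraction, and iterating it towards `0` identifies the whole
boundary with a paraboloid. If `χ = 1` for all of them, they act by isometries on the compact
pieces of the slices `y = c` of the boundary near `0`, hence all fix the centre `e` of the smallest
enclosing ball of such a piece. Some multiple of `e` lies in `Ω`, contradicting the existence of a
symmetry generator that does not vanish there. -/

section Exponential

variable {A : Type*} [NormedRing A] [NormedAlgebra ℝ A] [CompleteSpace A]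

/-- The exponential of a Banach algebra with values in the group of units. -/
noncomputable def expUnit (X : A) : Aˣ :=
  letI : NormedAlgebra ℚ A := NormedAlgebra.restrictScalars ℚ ℝ A
  { val := NormedSpace.exp X
    inv := NormedSpace.exp (-X)
    val_inv := by
      rw [← NormedSpace.exp_add_of_commute (Commute.refl X).neg_right, add_neg_cancel,
        NormedSpace.exp_zero]
    inv_val := by
      rw [← NormedSpace.exp_add_of_commute (Commute.refl X).neg_left, neg_add_cancel,
        NormedSpace.exp_zero] }

theorem val_expUnit (X : A) : (expUnit X : A) = NormedSpace.exp X := rfl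

theorem inv_expUnit (X : A) : (expUnit X)⁻¹ = expUnit (-X) := by
  ext; rfl

theorem expUnit_zero : expUnit (0 : A) = 1 := by
  ext; simp [val_expUnit]

theorem expUnit_add_smul (s t : ℝ) (X : A) :
    expUnit ((s + t) • X) = expUnit (s • X) * expUnit (t • X) := by
  let _ : NormedAlgebra ℚ A := NormedAlgebra.restrictScalars ℚ ℝ A
  ext
  rw [Units.val_mul, val_expUnit, val_expUnit, val_expUnit, add_smul,
    NormedSpace.exp_add_of_commute]
  exact ((Commute.refl X).smul_left s).smul_right t

theorem expUnit_nsmul (n : ℕ) (X : A) : expUnit (n • X) = expUnit X ^ n := by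
  let _ : NormedAlgebra ℚ A := NormedAlgebra.restrictScalars ℚ ℝ A
  ext
  rw [Units.val_pow_eq_pow_val, val_expUnit, val_expUnit, NormedSpace.exp_nsmul]

theorem expUnit_zsmul (n : ℤ) (X : A) : expUnit (n • X) = expUnit X ^ n := by
  obtain ⟨n, rfl | rfl⟩ := n.eq_nat_or_neg
  · rw [zpow_natCast, natCast_zsmul, expUnit_nsmul]
  · rw [zpow_neg, zpow_natCast, neg_smul, natCast_zsmul, ← inv_expUnit, expUnit_nsmul]

theorem continuous_expUnit : Continuous (expUnit : A → Aˣ) := by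
  let _ : NormedAlgebra ℚ A := NormedAlgebra.restrictScalars ℚ ℝ A
  rw [Units.continuous_iff]
  refine ⟨NormedSpace.exp_continuous, ?_⟩
  simp only [inv_expUnit, val_expUnit]
  exact NormedSpace.exp_continuous.comp continuous_neg

theorem hasStrictFDerivAt_val_expUnit_zero :
    HasStrictFDerivAt (fun X : A => (expUnit X : A))
      ((ContinuousLinearEquiv.refl ℝ A : A ≃L[ℝ] A) : A →L[ℝ] A) 0 := by
  let _ : NormedAlgebra ℚ A := NormedAlgebra.restrictScalars ℚ ℝ A
  exact hasStrictFDerivAt_exp_zero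

/-- The logarithm near `1`: the local inverse of the exponential at `0` given by the inverse
function theorem (a junk value away from `1`). -/
noncomputable def localLog : A → A :=
  hasStrictFDerivAt_val_expUnit_zero.localInverse _ _ _

theorem localLog_one : localLog (1 : A) = 0 := by
  have h := (hasStrictFDerivAt_val_expUnit_zero (A := A)).localInverse_apply_image
  rwa [expUnit_zero, Units.val_one] at h

theorem hasStrictFDerivAt_localLog_one :
    HasStrictFDerivAt localLog (ContinuousLinearMap.id ℝ A) 1 := by
  have h := (hasStrictFDerivAt_val_expUnit_zero (A := A)).to_localInverse
  rwa [expUnit_zero, Units.val_one] at h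

theorem eventually_expUnit_localLog :
    ∀ᶠ u : Aˣ in 𝓝 (1 : Aˣ), expUnit (localLog (u : A)) = u := by
  have h := (hasStrictFDerivAt_val_expUnit_zero (A := A)).eventually_right_inverse
  rw [expUnit_zero] at h
  exact ((Units.continuous_val.tendsto (1 : Aˣ)).eventually h).mono fun u hu => Units.ext hu

theorem tendsto_smul_localLog_expUnit_mul_expUnit {ι : Type*} {l : Filter ι} {c : ι → ℝ}
    {Y Z : ι → A} {X X' : A} (hY : Tendsto Y l (𝓝 0)) (hZ : Tendsto Z l (𝓝 0))
    (hcY : Tendsto (fun i => c i • Y i) l (𝓝 X)) (hcZ : Tendsto (fun i => c i • Z i) l (𝓝 X')) :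
    Tendsto (fun i => c i • localLog ((expUnit (Y i) * expUnit (Z i) : Aˣ) : A)) l
      (𝓝 (X + X')) := by
  have hexp : HasFDerivAt (fun X : A => (expUnit X : A)) (ContinuousLinearMap.id ℝ A) 0 :=
    hasStrictFDerivAt_val_expUnit_zero.hasFDerivAt
  have hfst : HasFDerivAt (fun p : A × A => (expUnit p.1 : A))
      ((ContinuousLinearMap.id ℝ A).comp (.fst ℝ A A)) 0 :=
    HasFDerivAt.comp (f := Prod.fst) (0 : A × A) hexp hasFDerivAt_fst
  have hsnd : HasFDerivAt (fun p : A × A => (expUnit p.2 : A))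
      ((ContinuousLinearMap.id ℝ A).comp (.snd ℝ A A)) 0 :=
    HasFDerivAt.comp (f := Prod.snd) (0 : A × A) hexp hasFDerivAt_snd
  have hlog : HasFDerivAt localLog (ContinuousLinearMap.id ℝ A)
      ((expUnit (0 : A) : A) * (expUnit (0 : A) : A)) := by
    simpa only [expUnit_zero, Units.val_one, mul_one] using
      hasStrictFDerivAt_localLog_one.hasFDerivAt
  have hlim := (hlog.comp (0 : A × A) (hfst.mul' hsnd)).hasFDerivWithinAt.lim (s := univ)
    (hY.prodMk_nhds hZ) (Eventually.of_forall fun _ => mem_univ _)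
    (by simpa using hcY.prodMk_nhds hcZ)
  simpa [expUnit_zero, localLog_one, add_comm] using hlim

end Exponential

section LieAlgebra

variable {A : Type*} [NormedRing A] [NormedAlgebra ℝ A] [CompleteSpace A]

/-- The Lie algebra of a group of units, as a set: the generators of the one-parameter subgroups
contained in the group. -/
def lieSet (G : Subgroup Aˣ) : Set A := {X | ∀ t : ℝ, expUnit (t • X) ∈ G}

theorem smul_mem_lieSet {G : Subgroup Aˣ} {X : A} (hX : X ∈ lieSet G) (c : ℝ) :
    c • X ∈ lieSet G := fun t => by
  rw [smul_smul]
  exact hX _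

theorem tendsto_floor_div_mul {ι : Type*} {l : Filter ι} {r : ι → ℝ} (hr : ∀ᶠ i in l, 0 < r i)
    (hr₀ : Tendsto r l (𝓝 0)) (t : ℝ) : Tendsto (fun i => (⌊t / r i⌋ : ℝ) * r i) l (𝓝 t) := by
  have hlower : Tendsto (fun i => t - r i) l (𝓝 t) := by simpa using tendsto_const_nhds.sub hr₀
  refine tendsto_of_tendsto_of_tendsto_of_le_of_le' hlower tendsto_const_nhds ?_ ?_
  · filter_upwards [hr] with i hi
    have h := (Int.sub_one_lt_floor (t / r i)).le
    rwa [← div_self hi.ne', ← sub_div, div_le_iff₀ hi] at h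
  · filter_upwards [hr] with i hi
    exact (le_div_iff₀ hi).1 (Int.floor_le _)

theorem mem_lieSet_of_tendsto {ι : Type*} {l : Filter ι} [l.NeBot] {G : Subgroup Aˣ}
    (hG : IsClosed (G : Set Aˣ)) {Y : ι → A} {r : ι → ℝ} {X : A} (hr : ∀ᶠ i in l, 0 < r i)
    (hr₀ : Tendsto r l (𝓝 0)) (hY : ∀ᶠ i in l, expUnit (Y i) ∈ G)
    (hX : Tendsto (fun i => (r i)⁻¹ • Y i) l (𝓝 X)) : X ∈ lieSet G := by
  intro t
  have hpow : Tendsto (fun i => expUnit (⌊t / r i⌋ • Y i)) l (𝓝 (expUnit (t • X))) := by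
    refine (continuous_expUnit.tendsto _).comp ?_
    refine ((tendsto_floor_div_mul hr hr₀ t).smul hX).congr' ?_
    filter_upwards [hr] with i hi
    rw [smul_smul, mul_assoc, mul_inv_cancel₀ hi.ne', mul_one, Int.cast_smul_eq_zsmul]
  refine hG.mem_of_tendsto hpow ?_
  filter_upwards [hY] with i hi
  rw [expUnit_zsmul]
  exact G.zpow_mem hi _

theorem add_mem_lieSet {G : Subgroup Aˣ} (hG : IsClosed (G : Set Aˣ)) {X Y : A}
    (hX : X ∈ lieSet G) (hY : Y ∈ lieSet G) : X + Y ∈ lieSet G := by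
  have hr : Tendsto (fun r : ℝ => r) (𝓝[>] 0) (𝓝 0) := nhdsWithin_le_nhds
  have hr_pos : ∀ᶠ r : ℝ in 𝓝[>] 0, 0 < r := self_mem_nhdsWithin
  have hsmall (Z : A) : Tendsto (fun r : ℝ => r • Z) (𝓝[>] 0) (𝓝 0) := by
    simpa using hr.smul_const Z
  have hrate (Z : A) : Tendsto (fun r : ℝ => r⁻¹ • r • Z) (𝓝[>] 0) (𝓝 Z) :=
    tendsto_const_nhds.congr' (hr_pos.mono fun r hr => (inv_smul_smul₀ hr.ne' Z).symm)
  have hone : Tendsto (fun r : ℝ => expUnit (r • X) * expUnit (r • Y)) (𝓝[>] 0) (𝓝 1) := by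
    simpa [expUnit_zero] using ((continuous_expUnit.tendsto 0).comp (hsmall X)).mul
      ((continuous_expUnit.tendsto 0).comp (hsmall Y))
  refine mem_lieSet_of_tendsto hG hr_pos hr ?_
    (tendsto_smul_localLog_expUnit_mul_expUnit (hsmall X) (hsmall Y) (hrate X) (hrate Y))
  filter_upwards [hone.eventually eventually_expUnit_localLog] with r hr
  rw [hr]
  exact G.mul_mem (hX r) (hY r)

/-- The Lie algebra of a closed group of units of a Banach algebra, as a subspace. -/
def lieSubmodule (G : Subgroup Aˣ) (hG : IsClosed (G : Set Aˣ)) : Submodule ℝ A where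
  carrier := lieSet G
  add_mem' := add_mem_lieSet hG
  zero_mem' := fun t => by rw [smul_zero, expUnit_zero]; exact G.one_mem
  smul_mem' := fun c _ hX => smul_mem_lieSet hX c

end LieAlgebra

section Operators

variable {V W : Type*} [NormedAddCommGroup V] [NormedSpace ℝ V] [CompleteSpace V]
  [NormedAddCommGroup W] [NormedSpace ℝ W] [CompleteSpace W]

theorem hasFDerivAt_expUnit_apply (v : V) :
    HasFDerivAt (fun X : V →L[ℝ] V => (expUnit X : V →L[ℝ] V) v)
      (ContinuousLinearMap.apply ℝ V v) 0 := by
  have hexp : HasFDerivAt (fun X : V →L[ℝ] V => (expUnit X : V →L[ℝ] V)) (.id ℝ (V →L[ℝ] V)) 0 :=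
    hasStrictFDerivAt_val_expUnit_zero.hasFDerivAt
  exact (ContinuousLinearMap.apply ℝ V v).hasFDerivAt.comp (0 : V →L[ℝ] V) hexp

theorem hasDerivAt_expUnit_smul_apply (X : V →L[ℝ] V) (v : V) :
    HasDerivAt (fun t : ℝ => (expUnit (t • X) : V →L[ℝ] V) v) (X v) 0 := by
  have hline : HasDerivAt (fun t : ℝ => t • X) X 0 := by
    simpa using (hasDerivAt_id (0 : ℝ)).smul_const X
  have happly : HasFDerivAt (fun X : V →L[ℝ] V => (expUnit X : V →L[ℝ] V) v)
      (ContinuousLinearMap.apply ℝ V v) ((0 : ℝ) • X) := by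
    simpa only [zero_smul] using hasFDerivAt_expUnit_apply v
  exact happly.comp_hasDerivAt (0 : ℝ) hline

theorem expUnit_comp_of_comp_eq {X : V →L[ℝ] V} {B : W →L[ℝ] W} {P : W →L[ℝ] V}
    (h : X ∘L P = P ∘L B) : (expUnit X : V →L[ℝ] V) ∘L P = P ∘L (expUnit B : W →L[ℝ] W) := by
  have hpow (k : ℕ) : (X ^ k) ∘L P = P ∘L (B ^ k) := by
    induction k with
    | zero => ext; simp
    | succ k ih =>
      rw [pow_succ, pow_succ', ContinuousLinearMap.mul_def, ContinuousLinearMap.mul_def,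
        ContinuousLinearMap.comp_assoc, h, ← ContinuousLinearMap.comp_assoc, ih,
        ContinuousLinearMap.comp_assoc, ← ContinuousLinearMap.mul_def, ← pow_succ, pow_succ',
        ContinuousLinearMap.mul_def]
  have hX : HasSum (fun k : ℕ => (k.factorial : ℝ)⁻¹ • X ^ k) (expUnit X : V →L[ℝ] V) :=
    NormedSpace.exp_series_hasSum_exp' X
  have hB : HasSum (fun k : ℕ => (k.factorial : ℝ)⁻¹ • B ^ k) (expUnit B : W →L[ℝ] W) :=
    NormedSpace.exp_series_hasSum_exp' B
  refine (hX.mapL ((ContinuousLinearMap.compL ℝ W V V).flip P)).unique ?_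
  refine (hB.mapL (ContinuousLinearMap.compL ℝ W W V P)).congr_fun fun k => ?_
  change ((k.factorial : ℝ)⁻¹ • X ^ k) ∘L P = P ∘L ((k.factorial : ℝ)⁻¹ • B ^ k)
  rw [ContinuousLinearMap.smul_comp, ContinuousLinearMap.comp_smul, hpow]

theorem expUnit_apply_of_apply_eq_zero {X : V →L[ℝ] V} {v : V} (h : X v = 0) :
    (expUnit X : V →L[ℝ] V) v = v := by
  have hcomp : X ∘L .toSpanSingleton ℝ v = .toSpanSingleton ℝ v ∘L (0 : ℝ →L[ℝ] ℝ) := by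
    ext
    simp [h]
  simpa [expUnit_zero] using DFunLike.congr_fun (expUnit_comp_of_comp_eq hcomp) 1

end Operators

section OrbitDirections

theorem exists_ultrafilter_tendsto_inv_norm_smul {W ι : Type*} [NormedAddCommGroup W]
    [NormedSpace ℝ W] [ProperSpace W] (l : Filter ι) [l.NeBot] (Y : ι → W) :
    ∃ F : Ultrafilter ι, (F : Filter ι) ≤ l ∧ ∃ X, Tendsto (fun i => ‖Y i‖⁻¹ • Y i) F (𝓝 X) := by
  obtain ⟨X, -, hX⟩ := isCompact_iff_ultrafilter_le_nhds.1 (isCompact_closedBall (0 : W) 1)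
    ((Ultrafilter.of l).map fun i => ‖Y i‖⁻¹ • Y i) (by
      refine tendsto_principal.2 (Eventually.of_forall fun i => ?_)
      rw [mem_closedBall_zero_iff, norm_smul, norm_inv, norm_norm]
      exact inv_mul_le_one)
  exact ⟨.of l, Ultrafilter.of_le l, X, hX⟩

variable {V : Type*} [NormedAddCommGroup V] [NormedSpace ℝ V] [FiniteDimensional ℝ V]

/-- The logarithms of the elements of the linear group `G` that map `v` to `u`. -/
def orbitLogs (G : Subgroup (V →L[ℝ] V)ˣ) (v u : V) : Set (V →L[ℝ] V) :=
  {Y | expUnit Y ∈ G ∧ (expUnit Y : V →L[ℝ] V) v = u}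

variable {G : Subgroup (V →L[ℝ] V)ˣ} {v w : V}

theorem isClosed_orbitLogs (hG : IsClosed (G : Set (V →L[ℝ] V)ˣ)) (v u : V) :
    IsClosed (orbitLogs G v u) := by
  refine (hG.preimage continuous_expUnit).inter (isClosed_eq ?_ continuous_const)
  exact (Units.continuous_val.comp continuous_expUnit).clm_apply continuous_const

theorem eventually_exists_mem_orbitLogs_norm_lt
    (horbit : ∀ U ∈ 𝓝 (1 : (V →L[ℝ] V)ˣ), ∀ᶠ s in 𝓝 (0 : ℝ), ∃ g ∈ G, g ∈ U ∧
      (g : V →L[ℝ] V) v = v + s • w) {δ : ℝ} (hδ : 0 < δ) :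
    ∀ᶠ s in 𝓝 (0 : ℝ), ∃ Y ∈ orbitLogs G v (v + s • w), ‖Y‖ < δ := by
  have hlog : Tendsto (fun u : (V →L[ℝ] V)ˣ => ‖localLog (u : V →L[ℝ] V)‖) (𝓝 1) (𝓝 0) := by
    have h : Tendsto (localLog : (V →L[ℝ] V) → V →L[ℝ] V) (𝓝 1) (𝓝 0) := by
      simpa only [localLog_one] using
        (hasStrictFDerivAt_localLog_one (A := V →L[ℝ] V)).hasFDerivAt.continuousAt.tendsto
    simpa using (h.comp (Units.continuous_val.tendsto (1 : (V →L[ℝ] V)ˣ))).norm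
  filter_upwards [horbit _ (eventually_expUnit_localLog.and (hlog.eventually (gt_mem_nhds hδ)))]
  rintro s ⟨g, hgG, ⟨hexp, hlt⟩, hgv⟩
  exact ⟨localLog g, ⟨by rwa [hexp], by rwa [hexp]⟩, hlt⟩

theorem exists_minimal_orbitLogs (hG : IsClosed (G : Set (V →L[ℝ] V)ˣ))
    (horbit : ∀ U ∈ 𝓝 (1 : (V →L[ℝ] V)ˣ), ∀ᶠ s in 𝓝 (0 : ℝ), ∃ g ∈ G, g ∈ U ∧
      (g : V →L[ℝ] V) v = v + s • w) :
    ∃ Y : ℝ → V →L[ℝ] V, Tendsto Y (𝓝 0) (𝓝 0) ∧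
      ∀ᶠ s in 𝓝 (0 : ℝ), Y s ∈ orbitLogs G v (v + s • w) ∧
        ∀ Y' ∈ orbitLogs G v (v + s • w), ‖Y s‖ ≤ ‖Y'‖ := by
  have hmin (s : ℝ) (hs : (orbitLogs G v (v + s • w)).Nonempty) :
      ∃ Y ∈ orbitLogs G v (v + s • w), ∀ Y' ∈ orbitLogs G v (v + s • w), ‖Y‖ ≤ ‖Y'‖ := by
    obtain ⟨Y, hY, h⟩ := (isClosed_orbitLogs hG v (v + s • w)).exists_infDist_eq_dist hs 0
    refine ⟨Y, hY, fun Y' hY' => ?_⟩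
    simpa only [h, dist_zero_left] using Metric.infDist_le_dist_of_mem (x := 0) hY'
  choose! Y hY hY_min using hmin
  refine ⟨Y, tendsto_zero_iff_norm_tendsto_zero.2 <| Metric.tendsto_nhds.2 fun δ hδ => ?_, ?_⟩
  · filter_upwards [eventually_exists_mem_orbitLogs_norm_lt horbit hδ] with s hs
    obtain ⟨Y', hY', hlt⟩ := hs
    simpa using (hY_min s ⟨Y', hY'⟩ Y' hY').trans_lt hlt
  · filter_upwards [eventually_exists_mem_orbitLogs_norm_lt horbit one_pos] with s hs
    have hne : (orbitLogs G v (v + s • w)).Nonempty := hs.imp fun _ h => h.1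
    exact ⟨hY s hne, hY_min s hne⟩

-- If `X v = 0`, then `exp Y * exp (-‖Y‖ X)` maps `v` to the same point as `exp Y`, but its
-- logarithm is `o(‖Y‖)`.
theorem apply_ne_zero_of_minimal_orbitLogs {ι : Type*} {l : Filter ι} [l.NeBot]
    {Y : ι → V →L[ℝ] V} {u : ι → V} {X : V →L[ℝ] V} (hXG : X ∈ lieSet G)
    (hY : Tendsto Y l (𝓝 0)) (hY_ne : ∀ᶠ i in l, Y i ≠ 0)
    (hX : Tendsto (fun i => ‖Y i‖⁻¹ • Y i) l (𝓝 X))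
    (hmin : ∀ᶠ i in l, Y i ∈ orbitLogs G v (u i) ∧ ∀ Y' ∈ orbitLogs G v (u i), ‖Y i‖ ≤ ‖Y'‖) :
    X v ≠ 0 := by
  intro hXv
  have hZ : Tendsto (fun i => -‖Y i‖ • X) l (𝓝 0) := by simpa using hY.norm.neg.smul_const X
  have hZX : Tendsto (fun i => ‖Y i‖⁻¹ • -‖Y i‖ • X) l (𝓝 (-X)) := by
    refine tendsto_const_nhds.congr' (hY_ne.mono fun i hi => ?_)
    simp only [smul_smul, mul_neg, inv_mul_cancel₀ (norm_ne_zero_iff.2 hi), neg_one_smul]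
  have hlog := (tendsto_smul_localLog_expUnit_mul_expUnit hY hZ hX hZX).norm
  rw [add_neg_cancel, norm_zero] at hlog
  have hone : Tendsto (fun i => expUnit (Y i) * expUnit (-‖Y i‖ • X)) l (𝓝 1) := by
    simpa [expUnit_zero] using ((continuous_expUnit.tendsto 0).comp hY).mul
      ((continuous_expUnit.tendsto 0).comp hZ)
  refine one_pos.not_ge (ge_of_tendsto hlog ?_)
  filter_upwards [hY_ne, hmin, hone.eventually eventually_expUnit_localLog] with i hi hmin hexp
  have hfix : (expUnit (-‖Y i‖ • X) : V →L[ℝ] V) v = v :=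
    expUnit_apply_of_apply_eq_zero (by simp [hXv])
  have hmem : localLog ((expUnit (Y i) * expUnit (-‖Y i‖ • X) : (V →L[ℝ] V)ˣ) : V →L[ℝ] V) ∈
      orbitLogs G v (u i) := by
    refine ⟨by rw [hexp]; exact G.mul_mem hmin.1.1 (hXG _), ?_⟩
    rw [hexp, Units.val_mul, mul_apply_eq_comp, hfix]
    exact hmin.1.2
  rw [norm_smul, norm_inv, norm_norm, inv_mul_eq_div, one_le_div (norm_pos_iff.2 hi)]
  exact hmin.2 _ hmem

theorem exists_mem_lieSet_apply_eq (hG : IsClosed (G : Set (V →L[ℝ] V)ˣ))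
    (horbit : ∀ U ∈ 𝓝 (1 : (V →L[ℝ] V)ˣ), ∀ᶠ s in 𝓝 (0 : ℝ), ∃ g ∈ G, g ∈ U ∧
      (g : V →L[ℝ] V) v = v + s • w) :
    ∃ X ∈ lieSet G, X v = w := by
  rcases eq_or_ne w 0 with rfl | hw
  · exact ⟨0, (lieSubmodule G hG).zero_mem, rfl⟩
  obtain ⟨Y, hY₀, hY⟩ := exists_minimal_orbitLogs hG horbit
  obtain ⟨F, hF, X, hX⟩ := exists_ultrafilter_tendsto_inv_norm_smul (𝓝[≠] (0 : ℝ)) Y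
  have hF₀ : (F : Filter ℝ) ≤ 𝓝 0 := hF.trans nhdsWithin_le_nhds
  have hY_ne : ∀ᶠ s in (F : Filter ℝ), Y s ≠ 0 := by
    filter_upwards [hF₀ hY, hF self_mem_nhdsWithin] with s hs hs₀ hYs
    have h := hs.1.2
    rw [hYs, expUnit_zero, Units.val_one, one_apply_eq_self, left_eq_add, smul_eq_zero] at h
    exact h.elim hs₀ hw
  have hXG : X ∈ lieSet G :=
    mem_lieSet_of_tendsto hG (hY_ne.mono fun s hs => norm_pos_iff.2 hs)
      (by simpa using (hY₀.mono_left hF₀).norm) ((hY.filter_mono hF₀).mono fun s hs => hs.1.1) hX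
  have hXv := apply_ne_zero_of_minimal_orbitLogs hXG (hY₀.mono_left hF₀) hY_ne hX
    (hY.filter_mono hF₀)
  have hspan : X v ∈ Submodule.span ℝ {w} := by
    have hlim := (hasFDerivAt_expUnit_apply v).hasFDerivWithinAt.lim (s := univ)
      (hY₀.mono_left hF₀) (Eventually.of_forall fun _ => mem_univ _) hX
    refine (Submodule.closed_of_finiteDimensional (Submodule.span ℝ {w})).mem_of_tendsto hlim ?_
    filter_upwards [hY.filter_mono hF₀] with s hs
    rw [zero_add, hs.1.2, expUnit_zero, Units.val_one, one_apply_eq_self, add_sub_cancel_left]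
    exact Submodule.smul_mem _ _ (Submodule.smul_mem _ _ (Submodule.mem_span_singleton_self w))
  obtain ⟨c, hc⟩ := Submodule.mem_span_singleton.1 hspan
  have hc₀ : c ≠ 0 := fun h => hXv (by rw [← hc, h, zero_smul])
  exact ⟨c⁻¹ • X, smul_mem_lieSet hXG _, by simp [← hc, hc₀]⟩

end OrbitDirections

section Stabilizer

open scoped Pointwise

variable {G X : Type*} [Group G] [TopologicalSpace G] [TopologicalSpace X]
  [MulAction G X] [ContinuousSMul G X]

theorem stabilizer_le_stabilizer_closure (C : Set X) :
    MulAction.stabilizer G C ≤ MulAction.stabilizer G (closure C) := fun g hg => by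
  rw [MulAction.mem_stabilizer_iff, ← closure_smul, MulAction.mem_stabilizer_iff.1 hg]

theorem stabilizer_le_stabilizer_closure_diff (C : Set X) :
    MulAction.stabilizer G C ≤ MulAction.stabilizer G (closure C \ C) := fun g hg => by
  have hg' := stabilizer_le_stabilizer_closure C hg
  rw [MulAction.mem_stabilizer_iff] at hg hg' ⊢
  rw [smul_set_sdiff, hg', hg]

theorem stabilizer_eq_inf (C : Set X) : MulAction.stabilizer G C =
    MulAction.stabilizer G (closure C) ⊓ MulAction.stabilizer G (closure C \ C) := by
  refine le_antisymm
    (le_inf (stabilizer_le_stabilizer_closure C) (stabilizer_le_stabilizer_closure_diff C)) ?_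
  rintro g ⟨hg, hg'⟩
  rw [← sdiff_sdiff_eq_self (subset_closure (s := C))]
  rw [MulAction.mem_stabilizer_iff, smul_set_sdiff, MulAction.mem_stabilizer_iff.1 hg,
    MulAction.mem_stabilizer_iff.1 hg']

variable [IsTopologicalGroup G]

theorem isClosed_stabilizer_of_isClosed {C : Set X} (hC : IsClosed C) :
    IsClosed (MulAction.stabilizer G C : Set G) := by
  have heq : (MulAction.stabilizer G C : Set G) =
      (⋂ v ∈ C, (fun g : G => g • v) ⁻¹' C) ∩ ⋂ v ∈ C, (fun g : G => g⁻¹ • v) ⁻¹' C := by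
    ext g
    simp only [SetLike.mem_coe, mem_inter_iff, mem_iInter, mem_preimage]
    rw [MulAction.mem_stabilizer_iff, subset_antisymm_iff, smul_set_subset_iff,
      subset_smul_set_iff, smul_set_subset_iff]
  rw [heq]
  refine IsClosed.inter ?_ ?_ <;>
    exact isClosed_biInter fun v _ => hC.preimage (by fun_prop)

theorem isClosed_stabilizer_of_isLocallyClosed {C : Set X} (hC : IsLocallyClosed C) :
    IsClosed (MulAction.stabilizer G C : Set G) := by
  have hdiff : IsClosed (closure C \ C) := by
    simpa only [coborder, isOpen_compl_iff] using hC.isOpen_coborder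
  rw [stabilizer_eq_inf]
  exact (isClosed_stabilizer_of_isClosed isClosed_closure).inter
    (isClosed_stabilizer_of_isClosed hdiff)

theorem eventually_exists_mem_stabilizer_smul_eq [SigmaCompactSpace G] [LocallyCompactSpace X]
    [T2Space X] {C : Set X} (hC : IsLocallyClosed C)
    (htrans : ∀ v ∈ C, ∀ v' ∈ C, ∃ g ∈ MulAction.stabilizer G C, g • v = v') {v : X} (hv : v ∈ C)
    {U : Set G} (hU : U ∈ 𝓝 (1 : G)) :
    ∀ᶠ v' in 𝓝[C] v, ∃ g ∈ MulAction.stabilizer G C, g ∈ U ∧ g • v = v' := by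
  have := hC.locallyCompactSpace
  have : SigmaCompactSpace (MulAction.stabilizer G C) :=
    (isClosed_stabilizer_of_isLocallyClosed hC).isClosedEmbedding_subtypeVal.sigmaCompactSpace
  have : ContinuousSMul (MulAction.stabilizer G C) C := by
    refine ⟨Continuous.subtype_mk (f := fun p : MulAction.stabilizer G C × C =>
      (p.1 : G) • (p.2 : X)) ?_ _⟩
    fun_prop
  have : MulAction.IsPretransitive (MulAction.stabilizer G C) C := by
    refine ⟨fun a b => ?_⟩
    obtain ⟨g, hg, h⟩ := htrans a a.2 b b.2
    exact ⟨⟨g, hg⟩, Subtype.ext h⟩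
  have hU' : Subtype.val ⁻¹' U ∈ 𝓝 (1 : MulAction.stabilizer G C) :=
    continuous_subtype_val.tendsto _ hU
  have horbit := (isOpenMap_smul_of_sigmaCompact (G := MulAction.stabilizer G C)
    (⟨v, hv⟩ : C)).image_mem_nhds hU'
  rw [one_smul] at horbit
  obtain ⟨W, hW, hWC⟩ := (mem_nhds_subtype _ _ _).1 horbit
  filter_upwards [mem_nhdsWithin_of_mem_nhds hW, self_mem_nhdsWithin] with v' hv' hv'C
  obtain ⟨g, hg, hgv⟩ := hWC (show (⟨v', hv'C⟩ : C) ∈ Subtype.val ⁻¹' W from hv')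
  exact ⟨g, g.2, hg, congrArg Subtype.val hgv⟩

end Stabilizer

section Homogenization

open scoped Pointwise

instance instContinuousSMulUnitsContinuousLinearMap {V : Type*} [NormedAddCommGroup V]
    [NormedSpace ℝ V] : ContinuousSMul (V →L[ℝ] V)ˣ V :=
  ⟨(Units.continuous_val.comp continuous_fst).clm_apply continuous_snd⟩

variable {E : Type*} [NormedAddCommGroup E] [NormedSpace ℝ E]

/-- Affine homogeneity of a subset of an arbitrary real vector space. -/
def HasTransitiveAffineSymmetries {E : Type*} [AddCommGroup E] [Module ℝ E] (Ω : Set E) : Prop :=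
  ∀ x ∈ Ω, ∀ y ∈ Ω, ∃ g : E ≃ᵃ[ℝ] E, g '' Ω = Ω ∧ g x = y

/-- The affine symmetries of `S ⊆ E` as linear maps: an affine map of `E` is identified with the
linear map of `ℝ × E` that restricts to it on the slice `{1} × E`. -/
def linearizedSymmetryGroup (S : Set E) : Subgroup (ℝ × E →L[ℝ] ℝ × E)ˣ :=
  MulAction.stabilizer _ (({1} : Set ℝ) ×ˢ S)

theorem isLocallyClosed_singleton_prod {E : Type*} [TopologicalSpace E] {Ω : Set E}
    (hΩ : IsOpen Ω) : IsLocallyClosed (({1} : Set ℝ) ×ˢ Ω) :=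
  (isClosed_singleton.preimage continuous_fst).isLocallyClosed.inter
    (hΩ.preimage continuous_snd).isLocallyClosed

theorem isClosed_linearizedSymmetryGroup {Ω : Set E} (hΩ : IsOpen Ω) :
    IsClosed (linearizedSymmetryGroup Ω : Set (ℝ × E →L[ℝ] ℝ × E)ˣ) :=
  isClosed_stabilizer_of_isLocallyClosed (isLocallyClosed_singleton_prod hΩ)

theorem linearizedSymmetryGroup_le_frontier {Ω : Set E} (hΩ : IsOpen Ω) :
    linearizedSymmetryGroup Ω ≤ linearizedSymmetryGroup (frontier Ω) := by
  have h := stabilizer_le_stabilizer_closure_diff (G := (ℝ × E →L[ℝ] ℝ × E)ˣ)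
    (({1} : Set ℝ) ×ˢ Ω)
  rwa [closure_prod_eq, closure_singleton, prod_sdiff_prod, sdiff_self, empty_prod,
    union_empty, ← hΩ.frontier_eq] at h

theorem exists_linearization [FiniteDimensional ℝ E] (g : E ≃ᵃ[ℝ] E) :
    ∃ u : (ℝ × E →L[ℝ] ℝ × E)ˣ, ∀ z : E, u • ((1, z) : ℝ × E) = (1, g z) := by
  let e : (ℝ × E) ≃ₗ[ℝ] ℝ × E :=
    (LinearEquiv.refl ℝ ℝ).skewProd g.linear (LinearMap.toSpanSingleton ℝ E (g 0))
  refine ⟨ContinuousLinearEquiv.toUnit e.toContinuousLinearEquiv, fun z => ?_⟩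
  have hg : g.linear z + g 0 = g z := by simpa using (g.map_vadd 0 z).symm
  change e (1, z) = (1, g z)
  simp [e, LinearEquiv.skewProd_apply, hg]

theorem HasTransitiveAffineSymmetries.exists_mem_linearizedSymmetryGroup [FiniteDimensional ℝ E]
    {Ω : Set E} (hΩ : HasTransitiveAffineSymmetries Ω) {v v' : ℝ × E}
    (hv : v ∈ ({1} : Set ℝ) ×ˢ Ω) (hv' : v' ∈ ({1} : Set ℝ) ×ˢ Ω) :
    ∃ u ∈ linearizedSymmetryGroup Ω, u • v = v' := by
  rw [singleton_prod] at hv hv'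
  obtain ⟨x, hx, rfl⟩ := hv
  obtain ⟨y, hy, rfl⟩ := hv'
  obtain ⟨g, hgΩ, hgx⟩ := hΩ x hx y hy
  obtain ⟨u, hu⟩ := exists_linearization g
  refine ⟨u, ?_, by rw [hu, hgx]⟩
  rw [linearizedSymmetryGroup, MulAction.mem_stabilizer_iff, singleton_prod, ← image_smul,
    image_image]
  simp only [hu]
  rw [← image_image (Prod.mk 1) g, hgΩ]

end Homogenization

section Isotropy

open scoped Pointwise

theorem exists_apply_eq_zero_apply_ne_zero {K T V V' : Type*} [Field K] [AddCommGroup T]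
    [Module K T] [FiniteDimensional K T] [AddCommGroup V] [Module K V] [AddCommGroup V']
    [Module K V'] {f : T →ₗ[K] V} {g : T →ₗ[K] V'}
    (h : Module.finrank K (LinearMap.range f) < Module.finrank K (LinearMap.range g)) :
    ∃ X, f X = 0 ∧ g X ≠ 0 := by
  by_contra! hcon
  have hle : LinearMap.ker f ≤ LinearMap.ker g := fun X hX => hcon X hX
  have := Submodule.finrank_mono hle
  have := f.finrank_range_add_finrank_ker
  have := g.finrank_range_add_finrank_ker
  lia

variable {E : Type*} [NormedAddCommGroup E] [NormedSpace ℝ E] [FiniteDimensional ℝ E]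

variable {S Ω : Set E} {X : ℝ × E →L[ℝ] ℝ × E}

theorem expUnit_smul_apply_mem (hX : X ∈ lieSet (linearizedSymmetryGroup S)) {z : E}
    (hz : z ∈ S) (t : ℝ) :
    (expUnit (t • X) : ℝ × E →L[ℝ] ℝ × E) (1, z) ∈ ({1} : Set ℝ) ×ˢ S :=
  (MulAction.mem_stabilizer_set.1 (hX t) (1, z)).2 ⟨rfl, hz⟩

theorem fst_apply_eq_zero (hX : X ∈ lieSet (linearizedSymmetryGroup S)) {z : E} (hz : z ∈ S) :
    (X (1, z)).1 = 0 := by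
  have hder := (ContinuousLinearMap.fst ℝ ℝ E).hasFDerivAt.comp_hasDerivAt (0 : ℝ)
    (hasDerivAt_expUnit_smul_apply X (1, z))
  have hconst : ContinuousLinearMap.fst ℝ ℝ E ∘
      (fun t : ℝ => (expUnit (t • X) : ℝ × E →L[ℝ] ℝ × E) (1, z)) = fun _ => 1 :=
    funext fun t => (expUnit_smul_apply_mem hX hz t).1
  rw [hconst] at hder
  exact hder.unique (hasDerivAt_const _ _)

theorem exists_mem_lieSet_apply_eq_inr (hΩ : IsOpen Ω) (hΩ_trans : HasTransitiveAffineSymmetries Ω)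
    {x : E} (hx : x ∈ Ω) (w : E) :
    ∃ X ∈ lieSet (linearizedSymmetryGroup Ω), X (1, x) = (0, w) := by
  have : ProperSpace (ℝ × E →L[ℝ] ℝ × E) := FiniteDimensional.proper_real _
  have : ProperSpace (ℝ × E) := FiniteDimensional.proper_real _
  have : SigmaCompactSpace (ℝ × E →L[ℝ] ℝ × E)ˣ :=
    Units.isClosedEmbedding_embedProduct.sigmaCompactSpace
  have hmem : ((1, x) : ℝ × E) ∈ ({1} : Set ℝ) ×ˢ Ω := ⟨rfl, hx⟩
  refine exists_mem_lieSet_apply_eq (isClosed_linearizedSymmetryGroup hΩ) fun U hU => ?_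
  have hline : Tendsto (fun s : ℝ => ((1, x) : ℝ × E) + s • ((0, w) : ℝ × E)) (𝓝 0)
      (𝓝 (1, x)) := Continuous.tendsto' (by fun_prop) _ _ (by simp)
  refine (tendsto_nhdsWithin_iff.2 ⟨hline, ?_⟩).eventually
    (eventually_exists_mem_stabilizer_smul_eq (isLocallyClosed_singleton_prod hΩ)
      (fun v hv v' hv' => hΩ_trans.exists_mem_linearizedSymmetryGroup hv hv') hmem hU)
  filter_upwards [(continuous_snd.tendsto _).comp hline (hΩ.mem_nhds hx)] with s hs
  exact ⟨by simp, hs⟩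

theorem comp_inr_eq_inr_comp (hΩ : IsOpen Ω) (hne : Ω.Nonempty)
    (hX : X ∈ lieSet (linearizedSymmetryGroup Ω)) (hX₀ : X (1, 0) = 0) :
    X ∘L .inr ℝ ℝ E = .inr ℝ ℝ E ∘L (.snd ℝ ℝ E ∘L X ∘L .inr ℝ ℝ E) := by
  have hfst : LinearMap.ker ((ContinuousLinearMap.fst ℝ ℝ E ∘L X ∘L .inr ℝ ℝ E : E →L[ℝ] ℝ) :
      E →ₗ[ℝ] ℝ) = ⊤ := by
    refine Submodule.eq_top_of_nonempty_interior' _ (hne.mono fun z hz => ?_)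
    refine mem_interior.2 ⟨Ω, fun y hy => ?_, hΩ, hz⟩
    have h : X (0, y) = X (1, y) := by
      rw [show ((1, y) : ℝ × E) = (1, 0) + (0, y) by simp, map_add, hX₀, zero_add]
    simpa [h] using fst_apply_eq_zero hX hy
  ext1 z
  refine Prod.ext ?_ rfl
  simpa using (LinearMap.ker_eq_top.1 hfst ▸ rfl :
    ((ContinuousLinearMap.fst ℝ ℝ E ∘L X ∘L .inr ℝ ℝ E : E →L[ℝ] ℝ) : E →ₗ[ℝ] ℝ) z = 0)

theorem mem_lieSet_stabilizer_frontier (hΩ : IsOpen Ω) (hne : Ω.Nonempty)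
    (hX : X ∈ lieSet (linearizedSymmetryGroup Ω)) (hX₀ : X (1, 0) = 0) :
    (.snd ℝ ℝ E ∘L X ∘L .inr ℝ ℝ E) ∈
      lieSet (MulAction.stabilizer (E →L[ℝ] E)ˣ (frontier Ω)) := by
  intro t
  set B : E →L[ℝ] E := .snd ℝ ℝ E ∘L X ∘L .inr ℝ ℝ E
  have hcomp : (t • X) ∘L .inr ℝ ℝ E = .inr ℝ ℝ E ∘L (t • B) := by
    rw [ContinuousLinearMap.smul_comp, comp_inr_eq_inr_comp hΩ hne hX hX₀,
      ContinuousLinearMap.comp_smul]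
  have hslice (z : E) : expUnit (t • X) • ((1, z) : ℝ × E) = (1, expUnit (t • B) • z) := by
    have h₀ : (expUnit (t • X) : ℝ × E →L[ℝ] ℝ × E) (1, 0) = (1, 0) :=
      expUnit_apply_of_apply_eq_zero (by simp [hX₀])
    have hz : (expUnit (t • X) : ℝ × E →L[ℝ] ℝ × E) (0, z) =
        (0, (expUnit (t • B) : E →L[ℝ] E) z) :=
      DFunLike.congr_fun (expUnit_comp_of_comp_eq hcomp) z
    change (expUnit (t • X) : ℝ × E →L[ℝ] ℝ × E) (1, z) = _
    rw [show ((1, z) : ℝ × E) = (1, 0) + (0, z) by simp, map_add, h₀, hz]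
    simp [Units.smul_def]
  refine MulAction.mem_stabilizer_set.2 fun z => ?_
  have h := MulAction.mem_stabilizer_set.1 (linearizedSymmetryGroup_le_frontier hΩ (hX t)) (1, z)
  rw [hslice] at h
  simpa using h

theorem exists_mem_lieSet_stabilizer_frontier_apply_ne_zero (hΩ : IsOpen Ω)
    (hΩ_trans : HasTransitiveAffineSymmetries Ω) (h₀ : 0 ∈ frontier Ω) {W : Submodule ℝ E}
    (hW : W ≠ ⊤)
    (htan : ∀ (γ : ℝ → E) (v : E), HasDerivAt γ v 0 → γ 0 = 0 → (∀ t, γ t ∈ frontier Ω) → v ∈ W)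
    {x : E} (hx : x ∈ Ω) :
    ∃ B ∈ lieSet (MulAction.stabilizer (E →L[ℝ] E)ˣ (frontier Ω)), B x ≠ 0 := by
  let T := lieSubmodule (linearizedSymmetryGroup Ω) (isClosed_linearizedSymmetryGroup hΩ)
  let ev (z : E) : T →ₗ[ℝ] E :=
    ((ContinuousLinearMap.snd ℝ ℝ E ∘L ContinuousLinearMap.apply ℝ (ℝ × E) (1, z) :
      (ℝ × E →L[ℝ] ℝ × E) →L[ℝ] E) : (ℝ × E →L[ℝ] ℝ × E) →ₗ[ℝ] E) ∘ₗ T.subtype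
  have hev₀ : LinearMap.range (ev 0) ≤ W := by
    rintro _ ⟨X, rfl⟩
    have hX : (X : ℝ × E →L[ℝ] ℝ × E) ∈ lieSet (linearizedSymmetryGroup (frontier Ω)) :=
      fun t => linearizedSymmetryGroup_le_frontier hΩ (X.2 t)
    exact htan _ _ ((ContinuousLinearMap.snd ℝ ℝ E).hasFDerivAt.comp_hasDerivAt (0 : ℝ)
      (hasDerivAt_expUnit_smul_apply X.1 (1, 0))) (by simp [expUnit_zero])
      fun t => (expUnit_smul_apply_mem hX h₀ t).2
  have hevx : LinearMap.range (ev x) = ⊤ := LinearMap.range_eq_top.2 fun w => by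
    obtain ⟨X, hX, hXw⟩ := exists_mem_lieSet_apply_eq_inr hΩ hΩ_trans hx w
    exact ⟨⟨X, hX⟩, congrArg Prod.snd hXw⟩
  obtain ⟨⟨X, hX⟩, hX₀, hXx⟩ := exists_apply_eq_zero_apply_ne_zero (f := ev 0) (g := ev x) (by
    rw [hevx, finrank_top]
    exact (Submodule.finrank_mono hev₀).trans_lt (Submodule.finrank_lt hW))
  have hX' : X ∈ lieSet (linearizedSymmetryGroup (frontier Ω)) :=
    fun t => linearizedSymmetryGroup_le_frontier hΩ (hX t)
  have hX₀' : X (1, 0) = 0 := Prod.ext (fst_apply_eq_zero hX' h₀) hX₀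
  refine ⟨_, mem_lieSet_stabilizer_frontier hΩ ⟨x, hx⟩ hX hX₀', ?_⟩
  have h : X (0, x) = X (1, x) := by
    rw [show ((1, x) : ℝ × E) = (1, 0) + (0, x) by simp, map_add, hX₀', zero_add]
  change (X (0, x)).2 ≠ 0
  rwa [h]

end Isotropy

section SmallestEnclosingBall

open Metric

theorem exists_minimal_closedBall_superset {X : Type*} [PseudoMetricSpace X] [ProperSpace X]
    {K : Set X} (hK : Bornology.IsBounded K) (hK₀ : K.Nonempty) :
    ∃ b r, K ⊆ closedBall b r ∧ ∀ b' r', K ⊆ closedBall b' r' → r ≤ r' := by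
  obtain ⟨k, hk⟩ := hK₀
  obtain ⟨R, hR⟩ := hK.subset_closedBall k
  have hRk : dist k k ≤ R := hR hk
  have hclosed : IsClosed {p : X × ℝ | K ⊆ closedBall p.1 p.2} := by
    have : {p : X × ℝ | K ⊆ closedBall p.1 p.2} = ⋂ z ∈ K, {p : X × ℝ | dist z p.1 ≤ p.2} := by
      ext p
      simp [subset_def]
    rw [this]
    exact isClosed_biInter fun z _ => isClosed_le (by fun_prop) continuous_snd
  obtain ⟨⟨b, r⟩, ⟨⟨-, -, hrR⟩, hbr⟩, hmin⟩ :=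
    (((isCompact_closedBall k R).prod (isCompact_Icc (a := 0) (b := R))).inter_right
      hclosed).exists_isMinOn
      ⟨(k, R), ⟨⟨hRk, dist_nonneg.trans hRk, le_rfl⟩, hR⟩⟩ continuous_snd.continuousOn
  refine ⟨b, r, hbr, fun b' r' h' => (le_total r' R).elim (fun hr' => ?_) hrR.trans⟩
  have hkb' : dist k b' ≤ r' := h' hk
  exact hmin (a := (b', r')) ⟨⟨by simpa [dist_comm] using hkb'.trans hr',
    dist_nonneg.trans hkb', hr'⟩, h'⟩

variable {F : Type*} [NormedAddCommGroup F] [InnerProductSpace ℝ F] {K : Set F}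

theorem subset_closedBall_midpoint {b b' : F} {r : ℝ} (h : K ⊆ closedBall b r)
    (h' : K ⊆ closedBall b' r) :
    K ⊆ closedBall (midpoint ℝ b b') √(r ^ 2 - (dist b b' / 2) ^ 2) := by
  intro k hk
  refine Real.le_sqrt_of_sq_le ?_
  have hb : dist k b ^ 2 ≤ r ^ 2 := by gcongr; exact h hk
  have hb' : dist k b' ^ 2 ≤ r ^ 2 := by gcongr; exact h' hk
  have apollonius :=
    EuclideanGeometry.dist_sq_add_dist_sq_eq_two_mul_dist_midpoint_sq_add_half_dist_sq k b b'
  linarith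

theorem center_eq_of_minimal_closedBall_superset (hK₀ : K.Nonempty) {b b' : F} {r : ℝ}
    (h : K ⊆ closedBall b r) (h' : K ⊆ closedBall b' r)
    (hmin : ∀ c s, K ⊆ closedBall c s → r ≤ s) : b = b' := by
  obtain ⟨k, hk⟩ := hK₀
  have hr : 0 ≤ r := dist_nonneg.trans (h hk)
  have hle : r ≤ √(r ^ 2 - (dist b b' / 2) ^ 2) := hmin _ _ (subset_closedBall_midpoint h h')
  rcases hr.eq_or_lt with rfl | hr
  · exact (dist_le_zero.1 (h hk)).symm.trans (dist_le_zero.1 (h' hk))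
  · rw [Real.le_sqrt' hr] at hle
    exact dist_eq_zero.1 (by nlinarith)

theorem exists_forall_isometry_apply_eq [FiniteDimensional ℝ F] (hK : Bornology.IsBounded K)
    (hK₀ : K.Nonempty) : ∃ b : F, ∀ A : F → F, Isometry A → K ⊆ A '' K → A b = b := by
  have : ProperSpace F := FiniteDimensional.proper_real F
  obtain ⟨b, r, hbr, hmin⟩ := exists_minimal_closedBall_superset hK hK₀
  refine ⟨b, fun A hA hKA => (center_eq_of_minimal_closedBall_superset hK₀ hbr ?_ hmin).symm⟩
  exact hKA.trans ((image_mono hbr).trans (hA.mapsTo_closedBall b r).image_subset)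

end SmallestEnclosingBall

section Sides

variable {E : Type*} [NormedAddCommGroup E] [NormedSpace ℝ E] {Ω : Set E} {ρ : E → ℝ}
  {ℓ : E →L[ℝ] ℝ} {p : E}

theorem subset_of_isPreconnected_of_disjoint_frontier {X : Type*} [TopologicalSpace X]
    {T U : Set X} (hT : IsPreconnected T) (hU : IsOpen U) (h : (T ∩ U).Nonempty)
    (hd : Disjoint T (frontier U)) : T ⊆ U := by
  refine hT.subset_left_of_subset_union hU isClosed_closure.isOpen_compl
    (disjoint_compl_right.mono_left subset_closure) (fun x hx => ?_) h
  by_contra hcon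
  simp only [mem_union, mem_compl_iff, not_or, not_not] at hcon
  exact disjoint_left.1 hd hx (hU.frontier_eq ▸ ⟨hcon.2, hcon.1⟩)

theorem exists_isPreconnected_subset_pos [CompleteSpace E] (hρ : HasStrictFDerivAt ρ ℓ p)
    (hℓ : ℓ ≠ 0) (hp : ρ p = 0) {N : Set E} (hN : N ∈ 𝓝 p) :
    ∃ T : Set E, IsPreconnected T ∧ (∀ z ∈ T, z ∈ N ∧ 0 < ρ z) ∧ ∀ᶠ z in 𝓝 p, 0 < ρ z → z ∈ T := by
  have hrange : ℓ.range = ⊤ := LinearMap.range_eq_top.2 (LinearMap.surjective_of_ne_zero fun h =>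
    hℓ (ContinuousLinearMap.coe_inj.1 h))
  set φ := hρ.implicitToOpenPartialHomeomorph ρ ℓ hrange
  have hpφ : p ∈ φ.source := hρ.mem_implicitToOpenPartialHomeomorph_source hrange
  have hφp : φ p = 0 :=
    (hρ.implicitToOpenPartialHomeomorph_self hrange).trans (by rw [hp]; rfl)
  have hsymm : ∀ᶠ w in 𝓝 (0 : ℝ × ℓ.ker), w ∈ φ.target ∧ φ.symm w ∈ N := by
    rw [← hφp]
    exact (φ.open_target.eventually_mem (φ.map_source hpφ)).and ((φ.tendsto_symm hpφ).eventually hN)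
  obtain ⟨δ, hδ, hball⟩ := Metric.mem_nhds_iff.1 hsymm
  refine ⟨φ.symm '' (Metric.ball 0 δ ∩ {w | 0 < w.1}), ?_, ?_, ?_⟩
  · have hconvex : Convex ℝ (Metric.ball (0 : ℝ × ℓ.ker) δ ∩ {w | 0 < w.1}) :=
      (convex_ball 0 δ).inter (convex_halfSpace_gt (LinearMap.fst ℝ ℝ ℓ.ker).isLinear 0)
    exact hconvex.isPreconnected.image _ (φ.continuousOn_symm.mono fun w hw => (hball hw.1).1)
  · rintro _ ⟨w, ⟨hw, hw₀⟩, rfl⟩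
    refine ⟨(hball hw).2, ?_⟩
    have hρw : (φ (φ.symm w)).1 = ρ (φ.symm w) :=
      hρ.implicitToOpenPartialHomeomorph_fst hrange _
    rwa [← hρw, φ.right_inv (hball hw).1]
  · have hφ : Tendsto φ (𝓝 p) (𝓝 0) := hφp ▸ φ.continuousAt hpφ
    filter_upwards [hφ (Metric.ball_mem_nhds 0 hδ), φ.open_source.mem_nhds hpφ] with z hz hzφ hρz
    exact ⟨φ z, ⟨hz, hρz⟩, φ.left_inv hzφ⟩

theorem eventually_mem_of_frequently_mem_pos [CompleteSpace E] (hΩ : IsOpen Ω)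
    (hρ : HasStrictFDerivAt ρ ℓ p) (hℓ : ℓ ≠ 0) (hp : ρ p = 0)
    (hfr : ∀ᶠ z in 𝓝 p, z ∈ frontier Ω → ρ z = 0) (hpos : ∃ᶠ z in 𝓝 p, z ∈ Ω ∧ 0 < ρ z) :
    ∀ᶠ z in 𝓝 p, 0 < ρ z → z ∈ Ω := by
  obtain ⟨T, hT, hTρ, hTp⟩ := exists_isPreconnected_subset_pos hρ hℓ hp hfr
  obtain ⟨q, ⟨hqΩ, hqρ⟩, hqT⟩ := (hpos.and_eventually hTp).exists
  have hTΩ : T ⊆ Ω := subset_of_isPreconnected_of_disjoint_frontier hT hΩ ⟨q, hqT hqρ, hqΩ⟩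
    (disjoint_left.2 fun z hz hzΩ => (hTρ z hz).2.ne' ((hTρ z hz).1 hzΩ))
  exact hTp.mono fun z hz hzρ => hTΩ (hz hzρ)

theorem eventually_pos_mem_or_eventually_neg_mem [CompleteSpace E] (hΩ : IsOpen Ω)
    (hρ : HasStrictFDerivAt ρ ℓ p) (hℓ : ℓ ≠ 0) (hp : p ∈ frontier Ω)
    (hfr : ∀ᶠ z in 𝓝 p, z ∈ frontier Ω ↔ ρ z = 0) :
    (∀ᶠ z in 𝓝 p, 0 < ρ z → z ∈ Ω) ∨ ∀ᶠ z in 𝓝 p, ρ z < 0 → z ∈ Ω := by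
  have hρp : ρ p = 0 := hfr.self_of_nhds.1 hp
  have hΩp : ∃ᶠ z in 𝓝 p, (z ∈ Ω ∧ 0 < ρ z) ∨ (z ∈ Ω ∧ 0 < -ρ z) := by
    refine ((mem_closure_iff_frequently.1 (frontier_subset_closure hp)).and_eventually hfr).mono ?_
    rintro z ⟨hz, hzρ⟩
    have hz₀ : ρ z ≠ 0 := fun h => (hΩ.frontier_eq ▸ hzρ.2 h).2 hz
    rcases hz₀.lt_or_gt with h | h
    · exact .inr ⟨hz, neg_pos.2 h⟩
    · exact .inl ⟨hz, h⟩
  refine (frequently_or_distrib.1 hΩp).imp (fun h => ?_) fun h => ?_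
  · exact eventually_mem_of_frequently_mem_pos hΩ hρ hℓ hρp (hfr.mono fun z hz => hz.1) h
  · simpa using eventually_mem_of_frequently_mem_pos hΩ hρ.neg (neg_ne_zero.2 hℓ)
      (by simpa using hρp) (hfr.mono fun z hz hzΩ => by simpa using hz.1 hzΩ) h

theorem exists_add_smul_mem_of_mem_frontier [CompleteSpace E] (hΩ : IsOpen Ω)
    (hρ : HasStrictFDerivAt ρ ℓ p) (hp : p ∈ frontier Ω)
    (hfr : ∀ᶠ z in 𝓝 p, z ∈ frontier Ω ↔ ρ z = 0) {e : E} (he : 0 < ℓ e) :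
    ∃ s : ℝ, p + s • e ∈ Ω := by
  have hline : HasDerivAt (fun s : ℝ => p + s • e) e 0 := by
    simpa using ((hasDerivAt_id (0 : ℝ)).smul_const e).const_add p
  have hlim : Tendsto (fun s : ℝ => p + s • e) (𝓝 0) (𝓝 p) := by
    simpa using hline.continuousAt.tendsto
  have hderiv : HasDerivAt (fun s : ℝ => ρ (p + s • e)) (ℓ e) 0 :=
    HasFDerivAt.comp_hasDerivAt (f := fun s : ℝ => p + s • e) 0
      (by simpa using hρ.hasFDerivAt) hline
  have hsign := eventually_nhdsWithin_sign_eq_of_deriv_pos (hderiv.deriv ▸ he)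
    (by simpa using hfr.self_of_nhds.1 hp)
  have hℓ : ℓ ≠ 0 := fun h => he.ne' (by simp [h])
  rcases eventually_pos_mem_or_eventually_neg_mem hΩ hρ hℓ hp hfr with h | h
  · obtain ⟨s, hs, hsΩ, hsρ⟩ := (eventually_mem_nhdsWithin.and
      (((hlim.eventually h).and hsign).filter_mono (nhdsWithin_le_nhds (s := Ioi 0)))).exists
    exact ⟨s, hsΩ (sign_eq_one_iff.1 (hsρ.trans (sign_pos (sub_pos.2 hs))))⟩
  · obtain ⟨s, hs, hsΩ, hsρ⟩ := (eventually_mem_nhdsWithin.and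
      (((hlim.eventually h).and hsign).filter_mono (nhdsWithin_le_nhds (s := Iio 0)))).exists
    exact ⟨s, hsΩ (sign_eq_neg_one_iff.1 (hsρ.trans (sign_neg (sub_neg.2 hs))))⟩

end Sides

section ParabolicDefiningFunction

open Asymptotics

variable {F : Type*} [NormedAddCommGroup F]

/-- The size of a point `(x, y)` of `F × ℝ` in the parabolic scaling, in which `x` has weight `1`
and `y` has weight `2`. -/
def parabolicWeight (z : F × ℝ) : ℝ :=
  ‖z.1‖ ^ 2 + |z.2|

/-- A local equation `ρ = 0` of `S` at the origin whose leading part, in the parabolic scaling, is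
the equation `y = ‖x‖²` of a paraboloid. -/
structure IsParabolicDefiningFunction (S : Set (F × ℝ)) (ρ : F × ℝ → ℝ) : Prop where
  mem_iff : ∀ᶠ z in 𝓝 0, z ∈ S ↔ ρ z = 0
  continuousAt : ∀ᶠ z in 𝓝 0, ContinuousAt ρ z
  isLittleO : (fun z => ρ z - (z.2 - ‖z.1‖ ^ 2)) =o[𝓝 0] parabolicWeight

theorem norm_parabolicWeight (z : F × ℝ) : ‖parabolicWeight z‖ = ‖z.1‖ ^ 2 + |z.2| :=
  Real.norm_of_nonneg (add_nonneg (sq_nonneg _) (abs_nonneg _))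

variable {S : Set (F × ℝ)} {ρ : F × ℝ → ℝ}

namespace IsParabolicDefiningFunction

theorem isLittleO_nhdsWithin (h : IsParabolicDefiningFunction S ρ) :
    (fun z : F × ℝ => z.2 - ‖z.1‖ ^ 2) =o[𝓝[S] 0] parabolicWeight := by
  refine ((h.isLittleO.mono nhdsWithin_le_nhds).congr' ?_ .rfl).neg_left.congr_left
    fun z => neg_neg _
  filter_upwards [nhdsWithin_le_nhds h.mem_iff, self_mem_nhdsWithin] with z hz hzS
  rw [hz.1 hzS, zero_sub]

theorem exists_mem_segment [NormedSpace ℝ F] (h : IsParabolicDefiningFunction S ρ) :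
    ∃ δ > 0, ∀ a ∈ Metric.ball (0 : F × ℝ) δ, ∀ b ∈ Metric.ball (0 : F × ℝ) δ,
      2 * a.2 ≤ ‖a.1‖ ^ 2 → 2 * ‖b.1‖ ^ 2 ≤ b.2 → ∃ z ∈ segment ℝ a b, z ∈ S := by
  obtain ⟨δ, hδ, hball⟩ := Metric.eventually_nhds_iff_ball.1
    (h.mem_iff.and (h.continuousAt.and (h.isLittleO.bound (c := 1 / 3) (by norm_num))))
  refine ⟨δ, hδ, fun a ha b hb ha₂ hb₂ => ?_⟩
  have hseg : segment ℝ a b ⊆ Metric.ball 0 δ := (convex_ball 0 δ).segment_subset ha hb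
  have hcont : ContinuousOn ρ (segment ℝ a b) := fun z hz =>
    (hball z (hseg hz)).2.1.continuousWithinAt
  have ha₀ : ρ a ≤ 0 := by
    have := (abs_le.1 (hball a ha).2.2).2
    rw [norm_parabolicWeight] at this
    rcases abs_cases a.2 with ⟨h, -⟩ | ⟨h, -⟩ <;> nlinarith [sq_nonneg ‖a.1‖]
  have hb₀ : 0 ≤ ρ b := by
    have := (abs_le.1 (hball b hb).2.2).1
    rw [norm_parabolicWeight, abs_of_nonneg (hb₂.trans' (by positivity))] at this
    linarith
  obtain ⟨z, hz, hρz⟩ := (convex_segment a b).isPreconnected.intermediate_value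
    (left_mem_segment ℝ a b) (right_mem_segment ℝ a b) hcont ⟨ha₀, hb₀⟩
  exact ⟨z, hz, (hball z (hseg hz)).1.2 hρz⟩

theorem eventually_exists_mem_fiber [NormedSpace ℝ F] (h : IsParabolicDefiningFunction S ρ) :
    ∀ᶠ x in 𝓝 (0 : F), ∃ y ∈ Icc 0 (2 * ‖x‖ ^ 2), (x, y) ∈ S := by
  obtain ⟨δ, hδ, hseg⟩ := h.exists_mem_segment
  have hlim : Tendsto (fun x : F => (x, 2 * ‖x‖ ^ 2)) (𝓝 0) (𝓝 0) :=
    Continuous.tendsto' (by fun_prop) _ _ (by simp)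
  have hlim₀ : Tendsto (fun x : F => (x, (0 : ℝ))) (𝓝 0) (𝓝 0) :=
    Continuous.tendsto' (by fun_prop) _ _ rfl
  filter_upwards [hlim (Metric.ball_mem_nhds 0 hδ), hlim₀ (Metric.ball_mem_nhds 0 hδ)] with x hb ha
  obtain ⟨z, hz, hzS⟩ := hseg _ ha _ hb (by simp) le_rfl
  rw [← Prod.image_mk_segment_right, segment_eq_Icc (by positivity)] at hz
  obtain ⟨y, hy, rfl⟩ := hz
  exact ⟨y, hy, hzS⟩

theorem eventually_exists_mem_slice [NormedSpace ℝ F] [Nontrivial F]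
    (h : IsParabolicDefiningFunction S ρ) :
    ∀ᶠ c in 𝓝[>] (0 : ℝ), ∃ x : F, ‖x‖ ≤ √(2 * c) ∧ (x, c) ∈ S := by
  obtain ⟨δ, hδ, hseg⟩ := h.exists_mem_segment
  obtain ⟨u, hu⟩ := exists_norm_eq F zero_le_one
  have hlim : Tendsto (fun c : ℝ => (√(2 * c) • u, c)) (𝓝 0) (𝓝 0) :=
    Continuous.tendsto' (by fun_prop) _ _ (by simp)
  have hlim₀ : Tendsto (fun c : ℝ => ((0 : F), c)) (𝓝 0) (𝓝 0) :=
    Continuous.tendsto' (by fun_prop) _ _ rfl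
  filter_upwards [nhdsWithin_le_nhds (hlim (Metric.ball_mem_nhds 0 hδ)),
    nhdsWithin_le_nhds (hlim₀ (Metric.ball_mem_nhds 0 hδ)), self_mem_nhdsWithin] with c ha hb hc
  have hc₀ : 0 ≤ c := le_of_lt hc
  have hnorm : ‖√(2 * c) • u‖ = √(2 * c) := by
    rw [norm_smul, hu, mul_one, Real.norm_of_nonneg (Real.sqrt_nonneg _)]
  obtain ⟨z, hz, hzS⟩ := hseg _ ha _ hb
    (by rw [hnorm, Real.sq_sqrt (mul_nonneg zero_le_two hc₀)]) (by simpa using hc₀)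
  rw [← Prod.image_mk_segment_left] at hz
  obtain ⟨x, hx, rfl⟩ := hz
  have hsub : segment ℝ (√(2 * c) • u) 0 ⊆ Metric.closedBall 0 √(2 * c) :=
    (convex_closedBall 0 _).segment_subset (mem_closedBall_zero_iff.2 hnorm.le) (by simp)
  exact ⟨x, mem_closedBall_zero_iff.1 (hsub hx), hzS⟩

theorem exists_isolated_slice [NormedSpace ℝ F] [Nontrivial F]
    (h : IsParabolicDefiningFunction S ρ) :
    ∃ c > 0, ∃ r, {x | (x, c) ∈ S ∧ ‖x‖ < r}.Nonempty ∧ ∀ x, (x, c) ∈ S → ‖x‖ ≠ r := by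
  obtain ⟨δ, hδ, hball⟩ := Metric.eventually_nhds_iff_ball.1 (eventually_nhdsWithin_iff.1
    (h.isLittleO_nhdsWithin.bound (c := 1 / 3) (by norm_num)))
  have hsmall : ∀ᶠ c in 𝓝[>] (0 : ℝ), c < δ ∧ √(2 * c) < δ / 2 := by
    have hlim : Tendsto (fun c : ℝ => √(2 * c)) (𝓝 0) (𝓝 0) :=
      Continuous.tendsto' (by fun_prop) _ _ (by simp)
    exact nhdsWithin_le_nhds ((gt_mem_nhds hδ).and (hlim.eventually (gt_mem_nhds (by positivity))))
  obtain ⟨c, ⟨⟨x₀, hx₀, hx₀S⟩, hcδ, hcr⟩, hc : 0 < c⟩ :=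
    ((h.eventually_exists_mem_slice.and hsmall).and self_mem_nhdsWithin).exists
  refine ⟨c, hc, δ / 2, ⟨x₀, hx₀S, hx₀.trans_lt hcr⟩, fun x hxS hx => ?_⟩
  have hxc : (x, c) ∈ Metric.ball (0 : F × ℝ) δ := by
    rw [mem_ball_zero_iff, Prod.norm_mk, hx, max_lt_iff, Real.norm_of_nonneg hc.le]
    exact ⟨half_lt_self hδ, hcδ⟩
  have hlower := (abs_le.1 (hball _ hxc hxS)).1
  rw [norm_parabolicWeight, abs_of_pos hc, hx] at hlower
  have hcr' := (Real.sqrt_lt' (half_pos hδ)).1 hcr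
  linarith

variable [NormedSpace ℝ F] {α : Type*} {l : Filter α}

theorem tendsto_sub_norm_sq (h : IsParabolicDefiningFunction S ρ) {s N : α → ℝ} {P : α → F}
    (hs : Tendsto s l (𝓝 0)) (hs₀ : ∀ᶠ k in l, s k ≠ 0) (hP : P =O[l] (1 : α → ℝ))
    (hN : N =O[l] (1 : α → ℝ)) (hmem : ∀ᶠ k in l, (s k • P k, s k ^ 2 * N k) ∈ S) :
    Tendsto (fun k => N k - ‖P k‖ ^ 2) l (𝓝 0) := by
  have hs₁ : s =o[l] (1 : α → ℝ) := (isLittleO_one_iff ℝ).2 hs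
  have hz : Tendsto (fun k => ((s k • P k, s k ^ 2 * N k) : F × ℝ)) l (𝓝[S] 0) := by
    refine tendsto_nhdsWithin_iff.2 ⟨?_, hmem⟩
    refine Tendsto.prodMk_nhds ((isLittleO_one_iff ℝ).1 ?_) ((isLittleO_one_iff ℝ).1 ?_)
    · simpa using hs₁.smul_isBigO hP
    · simpa using (hs₁.pow two_pos).mul_isBigO hN
  have hscaled : (fun k => s k ^ 2 * (N k - ‖P k‖ ^ 2)) =o[l]
      fun k => s k ^ 2 * (‖P k‖ ^ 2 + |N k|) := by
    refine (h.isLittleO_nhdsWithin.comp_tendsto hz).congr (fun k => ?_) fun k => ?_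
    · simp [norm_smul, mul_pow, mul_sub]
    · simp [parabolicWeight, norm_smul, mul_pow, abs_mul, mul_add]
  have hsmall : (fun k => N k - ‖P k‖ ^ 2) =o[l] fun k => ‖P k‖ ^ 2 + |N k| :=
    ((isBigO_refl (fun k => (s k ^ 2)⁻¹) l).mul_isLittleO hscaled).congr'
      (hs₀.mono fun k hk => inv_mul_cancel_left₀ (pow_ne_zero 2 hk) _)
      (hs₀.mono fun k hk => inv_mul_cancel_left₀ (pow_ne_zero 2 hk) _)
  have hbound : (fun k => ‖P k‖ ^ 2 + |N k|) =O[l] (1 : α → ℝ) := by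
    have hP₂ : (fun k => ‖P k‖ ^ 2) =O[l] (1 : α → ℝ) :=
      (hP.norm_left.pow 2).congr_right fun _ => one_pow 2
    exact hP₂.add hN.abs_left
  exact (isLittleO_one_iff ℝ).1 (hsmall.trans_isBigO hbound)

theorem snd_eq_zero_of_tendsto [l.NeBot] (h : IsParabolicDefiningFunction S ρ) {t : α → ℝ}
    {z : α → F × ℝ} {v : F × ℝ} (ht : Tendsto t l (𝓝 0)) (ht₀ : ∀ᶠ k in l, 0 < t k)
    (hz : Tendsto (fun k => (t k)⁻¹ • z k) l (𝓝 v)) (hmem : ∀ᶠ k in l, z k ∈ S) : v.2 = 0 := by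
  have hs : Tendsto (fun k => √(t k)) l (𝓝 0) := by simpa using ht.sqrt
  have hN : Tendsto (fun k => ((t k)⁻¹ • z k).2) l (𝓝 v.2) := (continuous_snd.tendsto v).comp hz
  have hP : Tendsto (fun k => √(t k) • ((t k)⁻¹ • z k).1) l (𝓝 0) := by
    simpa using hs.smul ((continuous_fst.tendsto v).comp hz)
  have hlim := h.tendsto_sub_norm_sq hs (ht₀.mono fun k hk => (Real.sqrt_pos.2 hk).ne')
    (hP.isBigO_one ℝ) (hN.isBigO_one ℝ) (by
      filter_upwards [ht₀, hmem] with k hk hzk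
      convert hzk using 1
      ext
      · simp only [smul_smul, Prod.smul_fst]
        rw [← mul_assoc, Real.mul_self_sqrt hk.le, mul_inv_cancel₀ hk.ne', one_smul]
      · simp [Real.sq_sqrt hk.le, mul_inv_cancel_left₀ hk.ne'])
  simpa using tendsto_nhds_unique (hN.sub (hP.norm.pow 2)) hlim

theorem exists_curve_tendsto (h : IsParabolicDefiningFunction S ρ) (x : F) :
    ∃ m : ℝ → ℝ, Tendsto m (𝓝[>] 0) (𝓝 (‖x‖ ^ 2)) ∧
      ∀ᶠ s in 𝓝[>] (0 : ℝ), (s • x, s ^ 2 * m s) ∈ S := by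
  have hs : Tendsto id (𝓝[>] (0 : ℝ)) (𝓝 0) := nhdsWithin_le_nhds
  have hs₀ : ∀ᶠ s in 𝓝[>] (0 : ℝ), s ≠ 0 := eventually_mem_nhdsWithin.mono fun s hs => hs.ne'
  have hx : Tendsto (fun s : ℝ => s • x) (𝓝[>] 0) (𝓝 0) := by simpa using hs.smul_const x
  have hex : ∀ᶠ s in 𝓝[>] (0 : ℝ), ∃ m ∈ Icc 0 (2 * ‖x‖ ^ 2), (s • x, s ^ 2 * m) ∈ S := by
    filter_upwards [hx.eventually h.eventually_exists_mem_fiber, hs₀] with s ⟨y, hy, hyS⟩ hs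
    have hs2 : 0 < s ^ 2 := by positivity
    refine ⟨y / s ^ 2, ⟨div_nonneg hy.1 hs2.le, ?_⟩, by rwa [mul_div_cancel₀ _ hs2.ne']⟩
    rw [div_le_iff₀ hs2]
    simpa [norm_smul, mul_pow, mul_assoc, mul_comm, mul_left_comm] using hy.2
  obtain ⟨m, hm⟩ : ∃ m : ℝ → ℝ, ∀ᶠ s in 𝓝[>] (0 : ℝ),
      m s ∈ Icc 0 (2 * ‖x‖ ^ 2) ∧ (s • x, s ^ 2 * m s) ∈ S := hex.choice
  have hbdd : m =O[𝓝[>] 0] (1 : ℝ → ℝ) := .of_bound (2 * ‖x‖ ^ 2) <| hm.mono fun s hs => by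
    simpa [abs_of_nonneg hs.1.1] using hs.1.2
  have hlim := h.tendsto_sub_norm_sq hs hs₀ (isBigO_const_const x one_ne_zero _) hbdd
    (hm.mono fun s hs => hs.2)
  exact ⟨m, tendsto_sub_nhds_zero_iff.1 hlim, hm.mono fun s hs => hs.2⟩

end IsParabolicDefiningFunction

end ParabolicDefiningFunction

section LinearSymmetries

open Asymptotics

open scoped Pointwise

variable {F : Type*} [NormedAddCommGroup F] [InnerProductSpace ℝ F] {S : Set (F × ℝ)}
  {ρ : F × ℝ → ℝ}

theorem isLittleO_snd_mul_parabolicWeight {F : Type*} [NormedAddCommGroup F] {m : F × ℝ → ℝ}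
    (hm : Tendsto m (𝓝 0) (𝓝 0)) :
    (fun z : F × ℝ => z.2 * m z) =o[𝓝 0] parabolicWeight := by
  have hsnd : (fun z : F × ℝ => z.2) =O[𝓝 0] parabolicWeight :=
    .of_norm_le fun z => le_add_of_nonneg_left (sq_nonneg ‖z.1‖)
  simpa using hsnd.mul_isLittleO ((isLittleO_one_iff ℝ).2 hm)

theorem isLittleO_norm_sq_shear (b : F) :
    (fun z : F × ℝ => ‖z.1 + z.2 • b‖ ^ 2 - ‖z.1‖ ^ 2) =o[𝓝 0] parabolicWeight := by
  have hm : Tendsto (fun z : F × ℝ => 2 * inner ℝ z.1 b + z.2 * ‖b‖ ^ 2) (𝓝 0) (𝓝 0) :=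
    Continuous.tendsto' (by fun_prop) _ _ (by simp)
  refine (isLittleO_snd_mul_parabolicWeight hm).congr_left fun z => ?_
  rw [norm_add_sq_real, norm_smul, mul_pow, Real.norm_eq_abs, sq_abs, inner_smul_right]
  ring

namespace IsParabolicDefiningFunction

theorem shear (h : IsParabolicDefiningFunction S ρ) (b : F) :
    IsParabolicDefiningFunction {z : F × ℝ | (z.1 + z.2 • b, z.2) ∈ S}
      (fun z => ρ (z.1 + z.2 • b, z.2)) := by
  have hcont : Continuous fun z : F × ℝ => (z.1 + z.2 • b, z.2) := by fun_prop
  have hlim : Tendsto (fun z : F × ℝ => (z.1 + z.2 • b, z.2)) (𝓝 0) (𝓝 0) :=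
    hcont.tendsto' _ _ (by simp)
  have hshear := isLittleO_norm_sq_shear b
  have hweight : (fun z : F × ℝ => parabolicWeight (z.1 + z.2 • b, z.2)) =O[𝓝 0]
      parabolicWeight := by
    refine (hshear.isBigO.add (isBigO_refl parabolicWeight _)).congr_left fun z => ?_
    simp only [parabolicWeight]
    ring
  refine ⟨hlim.eventually h.mem_iff, (hlim.eventually h.continuousAt).mono fun z hz =>
    hz.comp (f := fun z : F × ℝ => (z.1 + z.2 • b, z.2)) hcont.continuousAt, ?_⟩
  refine (((h.isLittleO.comp_tendsto hlim).trans_isBigO hweight).sub hshear).congr_left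
    fun z => ?_
  simp only [Function.comp_apply]
  ring

theorem eq_paraboloid_of_contraction (h : IsParabolicDefiningFunction S ρ) {L : F → F} {χ : ℝ}
    (hχ₀ : 0 < χ) (hχ₁ : χ < 1) (hL : ∀ x, ‖L x‖ ^ 2 = χ * ‖x‖ ^ 2)
    (hS : ∀ x y, (L x, χ * y) ∈ S ↔ (x, y) ∈ S) : S = {z | z.2 = ‖z.1‖ ^ 2} := by
  have hLk (x : F) (k : ℕ) : ‖L^[k] x‖ ^ 2 = χ ^ k * ‖x‖ ^ 2 := by
    induction k with
    | zero => simp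
    | succ k ih => rw [Function.iterate_succ_apply', hL, ih, pow_succ]; ring
  have hSk (x : F) (y : ℝ) (k : ℕ) : (L^[k] x, χ ^ k * y) ∈ S ↔ (x, y) ∈ S := by
    induction k with
    | zero => simp
    | succ k ih => rw [Function.iterate_succ_apply', pow_succ', mul_assoc, hS, ih]
  have hχk : Tendsto (fun k : ℕ => χ ^ k) atTop (𝓝 0) :=
    tendsto_pow_atTop_nhds_zero_of_lt_one hχ₀.le hχ₁
  have hsub (x : F) (y : ℝ) (hxy : (x, y) ∈ S) : y = ‖x‖ ^ 2 := by
    have hP (k : ℕ) : ‖(√(χ ^ k))⁻¹ • L^[k] x‖ ^ 2 = ‖x‖ ^ 2 := by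
      rw [norm_smul, mul_pow, hLk, norm_inv, inv_pow, Real.norm_of_nonneg (Real.sqrt_nonneg _),
        Real.sq_sqrt (by positivity), inv_mul_cancel_left₀ (by positivity)]
    have hlim := h.tendsto_sub_norm_sq (N := fun _ => y)
      (P := fun k => (√(χ ^ k))⁻¹ • L^[k] x) (by simpa using hχk.sqrt)
      (.of_forall fun k => by positivity) (.of_bound ‖x‖ <| .of_forall fun k => by
        simpa using ((sq_eq_sq₀ (norm_nonneg _) (norm_nonneg _)).1 (hP k)).le)
      (isBigO_const_const y one_ne_zero _) (.of_forall fun k => by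
        rw [smul_inv_smul₀ (by positivity), Real.sq_sqrt (by positivity)]
        exact (hSk x y k).2 hxy)
    simp only [hP] at hlim
    exact sub_eq_zero.1 (tendsto_nhds_unique tendsto_const_nhds hlim)
  ext ⟨x, y⟩
  refine ⟨hsub x y, ?_⟩
  rintro (rfl : y = ‖x‖ ^ 2)
  have hx : Tendsto (fun k => L^[k] x) atTop (𝓝 0) := by
    have hsqrt := (hχk.mul_const (‖x‖ ^ 2)).sqrt
    simp only [← hLk, Real.sqrt_sq (norm_nonneg _), zero_mul, Real.sqrt_zero] at hsqrt
    exact tendsto_zero_iff_norm_tendsto_zero.2 hsqrt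
  obtain ⟨k, y, -, hy⟩ := (hx.eventually h.eventually_exists_mem_fiber).exists
  have hmem : (x, y / χ ^ k) ∈ S := by
    rwa [← hSk x _ k, mul_div_cancel₀ _ (by positivity)]
  rwa [hsub _ _ hmem] at hmem

section MapsTo

variable {g : F × ℝ →L[ℝ] F × ℝ}

theorem snd_apply_inl_eq_zero_and_norm_sq (h : IsParabolicDefiningFunction S ρ)
    (hg : MapsTo g S S) (x : F) :
    (g (x, 0)).2 = 0 ∧ ‖(g (x, 0)).1‖ ^ 2 = (g (0, 1)).2 * ‖x‖ ^ 2 := by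
  obtain ⟨m, hm, hmS⟩ := h.exists_curve_tendsto x
  have hs : Tendsto id (𝓝[>] (0 : ℝ)) (𝓝 0) := nhdsWithin_le_nhds
  have hs₀ : ∀ᶠ s in 𝓝[>] (0 : ℝ), 0 < s := self_mem_nhdsWithin
  have hgz (s : ℝ) : g (s • x, s ^ 2 * m s) = s • (g (x, 0) + (s * m s) • g (0, 1)) := by
    rw [← map_smul, ← map_add, ← map_smul]
    congr 1
    ext <;> simp [pow_two, mul_assoc]
  have hlim : Tendsto (fun s => g (x, 0) + (s * m s) • g (0, 1)) (𝓝[>] 0) (𝓝 (g (x, 0))) := by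
    simpa using ((hs.mul hm).smul_const (g (0, 1))).const_add (g (x, 0))
  have hzero : (g (x, 0)).2 = 0 := by
    refine h.snd_eq_zero_of_tendsto hs hs₀ (z := fun s => g (s • x, s ^ 2 * m s)) ?_
      (hmS.mono fun s hs => hg hs)
    refine hlim.congr' (hs₀.mono fun s hs => ?_)
    change _ = s⁻¹ • g (s • x, s ^ 2 * m s)
    rw [hgz, inv_smul_smul₀ hs.ne']
  refine ⟨hzero, ?_⟩
  have hP : Tendsto (fun s => (g (x, 0) + (s * m s) • g (0, 1)).1) (𝓝[>] 0)
      (𝓝 (g (x, 0)).1) := (continuous_fst.tendsto _).comp hlim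
  have hN : Tendsto (fun s => m s * (g (0, 1)).2) (𝓝[>] 0) (𝓝 (‖x‖ ^ 2 * (g (0, 1)).2)) :=
    hm.mul_const _
  have hsub := h.tendsto_sub_norm_sq hs (hs₀.mono fun s hs => hs.ne') (hP.isBigO_one ℝ)
    (hN.isBigO_one ℝ) (hmS.mono fun s hs => by
      convert hg hs using 1
      rw [hgz]
      ext
      · simp
      · simp [hzero, pow_two, mul_assoc])
  rw [mul_comm]
  exact (sub_eq_zero.1 (tendsto_nhds_unique (hN.sub (hP.norm.pow 2)) hsub)).symm

theorem snd_apply (h : IsParabolicDefiningFunction S ρ) (hg : MapsTo g S S) (z : F × ℝ) :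
    (g z).2 = (g (0, 1)).2 * z.2 := by
  have hz : z = (z.1, 0) + z.2 • ((0, 1) : F × ℝ) := by ext <;> simp
  conv_lhs => rw [hz]
  rw [map_add, map_smul, Prod.snd_add, (h.snd_apply_inl_eq_zero_and_norm_sq hg _).1, Prod.smul_snd,
    zero_add, smul_eq_mul, mul_comm]

end MapsTo

theorem snd_apply_mul_snd_apply_inv (h : IsParabolicDefiningFunction S ρ)
    {u : (F × ℝ →L[ℝ] F × ℝ)ˣ} (hu : u ∈ MulAction.stabilizer (F × ℝ →L[ℝ] F × ℝ)ˣ S) :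
    (u • ((0, 1) : F × ℝ)).2 * (u⁻¹ • ((0, 1) : F × ℝ)).2 = 1 := by
  have hmaps : MapsTo (u : F × ℝ →L[ℝ] F × ℝ) S S := fun z hz =>
    (MulAction.mem_stabilizer_set.1 hu z).2 hz
  have hsnd := h.snd_apply hmaps (u⁻¹ • ((0, 1) : F × ℝ))
  exact hsnd.symm.trans (congrArg Prod.snd (smul_inv_smul u ((0, 1) : F × ℝ)))

end IsParabolicDefiningFunction

end LinearSymmetries

section Paraboloid

open scoped Pointwise

variable {F : Type*} [NormedAddCommGroup F] [InnerProductSpace ℝ F] [FiniteDimensional ℝ F]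
  {S : Set (F × ℝ)} {ρ : F × ℝ → ℝ}

namespace IsParabolicDefiningFunction

theorem eq_paraboloid_of_linear_contraction (h : IsParabolicDefiningFunction S ρ)
    {g : F × ℝ →L[ℝ] F × ℝ} (hg : ∀ z, g z ∈ S ↔ z ∈ S) (hpos : 0 < (g (0, 1)).2)
    (hlt : (g (0, 1)).2 < 1) : ∃ b : F, S = {z | z.2 = ‖z.1 - z.2 • b‖ ^ 2} := by
  have hmaps : MapsTo g S S := fun z hz => (hg z).2 hz
  set χ := (g (0, 1)).2
  let L : F →ₗ[ℝ] F := LinearMap.fst ℝ F ℝ ∘ₗ (g : F × ℝ →ₗ[ℝ] F × ℝ) ∘ₗ LinearMap.inl ℝ F ℝ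
  have hL (x : F) : g (x, 0) = (L x, 0) :=
    Prod.ext rfl (h.snd_apply_inl_eq_zero_and_norm_sq hmaps x).1
  have hL_norm (x : F) : ‖L x‖ ^ 2 = χ * ‖x‖ ^ 2 :=
    (h.snd_apply_inl_eq_zero_and_norm_sq hmaps x).2
  have hinj : Function.Injective (χ • LinearMap.id - L : F →ₗ[ℝ] F) := by
    refine (injective_iff_map_eq_zero _).2 fun x hx => ?_
    have hnorm : χ ^ 2 * ‖x‖ ^ 2 = χ * ‖x‖ ^ 2 := by
      rw [← hL_norm, ← sub_eq_zero.1 hx, LinearMap.smul_apply, LinearMap.id_apply, norm_smul,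
        mul_pow, Real.norm_of_nonneg hpos.le]
    have hχ : χ ^ 2 ≠ χ := (pow_lt_self_of_lt_one₀ hpos hlt one_lt_two).ne
    simpa [hχ] using hnorm
  obtain ⟨b, hb⟩ := LinearMap.injective_iff_surjective.1 hinj (g (0, 1)).1
  have hgz (x : F) (y : ℝ) : g (x + y • b, y) = (L x + (χ * y) • b, χ * y) := by
    have hsplit : ((x + y • b, y) : F × ℝ) = (x, 0) + y • ((b, 0) + (0, 1)) := by ext <;> simp
    have hb' : L b + (g (0, 1)).1 = χ • b := by simp [← hb]
    rw [hsplit, map_add, map_smul, map_add, hL, hL]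
    ext
    · simp only [Prod.fst_add, Prod.smul_fst, hb', smul_smul, mul_comm]
    · simp [χ, mul_comm]
  have hshear : {z : F × ℝ | (z.1 + z.2 • b, z.2) ∈ S} = {z | z.2 = ‖z.1‖ ^ 2} :=
    (h.shear b).eq_paraboloid_of_contraction hpos hlt hL_norm fun x y => by
      simpa only [mem_ofPred_eq, hgz] using hg (x + y • b, y)
  refine ⟨b, ?_⟩
  ext ⟨x, y⟩
  simpa using Set.ext_iff.1 hshear (x - y • b, y)

theorem eq_paraboloid_of_mem_stabilizer [Nontrivial F] (h : IsParabolicDefiningFunction S ρ)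
    {u : (F × ℝ →L[ℝ] F × ℝ)ˣ} (hu : u ∈ MulAction.stabilizer (F × ℝ →L[ℝ] F × ℝ)ˣ S)
    (hne : (u • ((0, 1) : F × ℝ)).2 ≠ 1) : ∃ b : F, S = {z | z.2 = ‖z.1 - z.2 • b‖ ^ 2} := by
  have hinv := h.snd_apply_mul_snd_apply_inv hu
  have hmem {v : (F × ℝ →L[ℝ] F × ℝ)ˣ} (hv : v ∈ MulAction.stabilizer (F × ℝ →L[ℝ] F × ℝ)ˣ S)
      (z : F × ℝ) : (v : F × ℝ →L[ℝ] F × ℝ) z ∈ S ↔ z ∈ S := MulAction.mem_stabilizer_set.1 hv z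
  have hpos : 0 < (u • ((0, 1) : F × ℝ)).2 := by
    obtain ⟨x, hx⟩ := exists_ne (0 : F)
    have hnorm := (h.snd_apply_inl_eq_zero_and_norm_sq (fun z hz => (hmem hu z).2 hz) x).2
    refine (left_ne_zero_of_mul_eq_one hinv).symm.lt_of_le ?_
    exact nonneg_of_mul_nonneg_left (hnorm ▸ sq_nonneg _) (by positivity)
  rcases hne.lt_or_gt with hlt | hgt
  · exact h.eq_paraboloid_of_linear_contraction (hmem hu) hpos hlt
  · rw [mul_comm, mul_eq_one_iff_eq_inv₀ hpos.ne'] at hinv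
    have hpos' : 0 < (u⁻¹ • ((0, 1) : F × ℝ)).2 := hinv ▸ inv_pos.2 hpos
    have hlt' : (u⁻¹ • ((0, 1) : F × ℝ)).2 < 1 := hinv ▸ inv_lt_one_of_one_lt₀ hgt
    exact h.eq_paraboloid_of_linear_contraction (hmem (inv_mem hu)) hpos' hlt'

theorem apply_slice_mem (h : IsParabolicDefiningFunction S ρ) {B : F × ℝ →L[ℝ] F × ℝ}
    (hB : B ∈ lieSet (MulAction.stabilizer (F × ℝ →L[ℝ] F × ℝ)ˣ S))
    (hB₁ : ∀ t : ℝ, ((expUnit (t • B) : F × ℝ →L[ℝ] F × ℝ) (0, 1)).2 = 1) {x : F} {c r : ℝ}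
    (hr : ∀ x, (x, c) ∈ S → ‖x‖ ≠ r) (hxS : (x, c) ∈ S) (hx : ‖x‖ < r) (t : ℝ) :
    ∃ x', (expUnit (t • B) : F × ℝ →L[ℝ] F × ℝ) (x, c) = (x', c) ∧ (x', c) ∈ S ∧ ‖x'‖ < r := by
  let γ (t : ℝ) : F × ℝ := (expUnit (t • B) : F × ℝ →L[ℝ] F × ℝ) (x, c)
  have hγS (t : ℝ) : γ t ∈ S := (MulAction.mem_stabilizer_set.1 (hB t) _).2 hxS
  have hγ (t : ℝ) : γ t = ((γ t).1, c) := by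
    refine Prod.ext rfl ?_
    have hmaps : MapsTo (expUnit (t • B) : F × ℝ →L[ℝ] F × ℝ) S S := fun z hz =>
      (MulAction.mem_stabilizer_set.1 (hB t) z).2 hz
    exact (h.snd_apply hmaps _).trans (by rw [hB₁, one_mul])
  refine ⟨(γ t).1, hγ t, hγ t ▸ hγS t, lt_of_not_ge fun hge => ?_⟩
  have hcont : Continuous fun t => ‖(γ t).1‖ := by
    have hexp : Continuous fun t : ℝ => (expUnit (t • B) : F × ℝ →L[ℝ] F × ℝ) :=
      Units.continuous_val.comp (continuous_expUnit.comp (by fun_prop))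
    exact (continuous_fst.comp (hexp.clm_apply continuous_const)).norm
  have hγ₀ : ‖(γ 0).1‖ ≤ r := by
    simp only [γ, zero_smul, expUnit_zero]
    exact hx.le
  obtain ⟨t', ht'⟩ := mem_range_of_exists_le_of_exists_ge hcont ⟨0, hγ₀⟩ ⟨t, hge⟩
  exact hr _ (hγ t' ▸ hγS t') ht'

theorem exists_common_fixed_point [Nontrivial F] (h : IsParabolicDefiningFunction S ρ) :
    ∃ e : F × ℝ, 0 < e.2 ∧ ∀ B : F × ℝ →L[ℝ] F × ℝ,
      B ∈ lieSet (MulAction.stabilizer (F × ℝ →L[ℝ] F × ℝ)ˣ S) →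
      (∀ t : ℝ, ((expUnit (t • B) : F × ℝ →L[ℝ] F × ℝ) (0, 1)).2 = 1) → B e = 0 := by
  obtain ⟨c, hc, r, hne, hr⟩ := h.exists_isolated_slice
  set K : Set F := {x | (x, c) ∈ S ∧ ‖x‖ < r}
  have hK : Bornology.IsBounded K :=
    Metric.isBounded_ball.subset fun x hx => mem_ball_zero_iff.2 hx.2
  obtain ⟨b, hb⟩ := exists_forall_isometry_apply_eq hK hne
  refine ⟨(b, c), hc, fun B hB hB₁ => ?_⟩
  have hmaps (t : ℝ) : MapsTo (expUnit (t • B) : F × ℝ →L[ℝ] F × ℝ) S S := fun z hz =>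
    (MulAction.mem_stabilizer_set.1 (hB t) z).2 hz
  have hfix (t : ℝ) : (expUnit (t • B) : F × ℝ →L[ℝ] F × ℝ) (b, c) = (b, c) := by
    refine Prod.ext ?_ ((h.snd_apply (hmaps t) _).trans (by rw [hB₁, one_mul]))
    refine hb (fun x => ((expUnit (t • B) : F × ℝ →L[ℝ] F × ℝ) (x, c)).1)
      (Isometry.of_dist_eq fun x y => ?_) fun x hx => ?_
    · have hnorm := (h.snd_apply_inl_eq_zero_and_norm_sq (hmaps t) (x - y)).2
      rw [hB₁, one_mul, sq_eq_sq₀ (norm_nonneg _) (norm_nonneg _)] at hnorm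
      rw [dist_eq_norm, dist_eq_norm, ← hnorm, ← Prod.fst_sub, ← map_sub, Prod.mk_sub_mk, sub_self]
    · obtain ⟨x', hx', hx'S, hx'r⟩ := h.apply_slice_mem hB hB₁ hr hx.1 hx.2 (-t)
      refine ⟨x', ⟨hx'S, hx'r⟩, ?_⟩
      have hinv : expUnit (t • B) * expUnit (-t • B) = 1 := by
        rw [← expUnit_add_smul, add_neg_cancel, zero_smul, expUnit_zero]
      have happly :=
        congrArg (fun u : (F × ℝ →L[ℝ] F × ℝ)ˣ => (u : F × ℝ →L[ℝ] F × ℝ) (x, c)) hinv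
      simp only [← hx']
      exact congrArg Prod.fst happly
  have hder := hasDerivAt_expUnit_smul_apply B (b, c)
  simp only [hfix] at hder
  exact hder.unique (hasDerivAt_const 0 (b, c))

end IsParabolicDefiningFunction

theorem frontier_eq_paraboloid [Nontrivial F] {Ω : Set (F × ℝ)} (hΩ : IsOpen Ω)
    (hΩ_trans : HasTransitiveAffineSymmetries Ω) (h₀ : 0 ∈ frontier Ω)
    (h : IsParabolicDefiningFunction (frontier Ω) ρ)
    (hρ : HasStrictFDerivAt ρ (ContinuousLinearMap.snd ℝ F ℝ) 0) :
    ∃ b : F, frontier Ω = {z | z.2 = ‖z.1 - z.2 • b‖ ^ 2} := by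
  obtain ⟨e, he, hfix⟩ := h.exists_common_fixed_point
  obtain ⟨s, hs⟩ : ∃ s : ℝ, s • e ∈ Ω := by
    simpa only [zero_add] using exists_add_smul_mem_of_mem_frontier hΩ hρ h₀ h.mem_iff he
  have hW : LinearMap.ker (LinearMap.snd ℝ F ℝ) ≠ ⊤ := fun hker =>
    one_ne_zero (α := ℝ) (LinearMap.congr_fun (LinearMap.ker_eq_top.1 hker) ((0, 1) : F × ℝ))
  have htan (γ : ℝ → F × ℝ) (v : F × ℝ) (hγ : HasDerivAt γ v 0) (hγ₀ : γ 0 = 0)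
      (hγΩ : ∀ t, γ t ∈ frontier Ω) : v ∈ LinearMap.ker (LinearMap.snd ℝ F ℝ) := by
    have hslope := hγ.tendsto_slope_zero_right
    simp only [zero_add, hγ₀, sub_zero] at hslope
    exact h.snd_eq_zero_of_tendsto (l := 𝓝[>] (0 : ℝ)) (t := id) nhdsWithin_le_nhds
      self_mem_nhdsWithin hslope (.of_forall hγΩ)
  obtain ⟨B, hB, hBs⟩ :=
    exists_mem_lieSet_stabilizer_frontier_apply_ne_zero hΩ hΩ_trans h₀ hW htan hs
  by_cases hB₁ : ∀ t : ℝ, ((expUnit (t • B) : F × ℝ →L[ℝ] F × ℝ) (0, 1)).2 = 1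
  · rw [map_smul, hfix B hB hB₁, smul_zero] at hBs
    exact absurd rfl hBs
  · obtain ⟨t, ht⟩ := not_forall.1 hB₁
    exact h.eq_paraboloid_of_mem_stabilizer (hB t) ht

end Paraboloid

section SecondOrder

open Asymptotics

variable {E : Type*} [NormedAddCommGroup E] [NormedSpace ℝ E]

theorem hasFDerivAt_half_smul_apply_self {G : Type*} [NormedAddCommGroup G] [NormedSpace ℝ G]
    {H : E →L[ℝ] E →L[ℝ] G} (hH : ∀ v w, H v w = H w v) (v : E) :
    HasFDerivAt (fun v => (1 / 2 : ℝ) • H v v) (H v) v := by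
  refine ((H.hasFDerivAt.clm_apply (hasFDerivAt_id v)).const_smul (1 / 2 : ℝ)).congr_fderiv ?_
  ext w
  simp only [add_apply, smul_apply, ContinuousLinearMap.comp_apply, ContinuousLinearMap.flip_apply,
    id_eq, ContinuousLinearMap.id_apply, hH w v]
  module

theorem isLittleO_taylor_two {G : Type*} [NormedAddCommGroup G] [NormedSpace ℝ G] {f : E → G}
    {p : E} (hf : ContDiffAt ℝ 2 f p) :
    (fun v => f (p + v) - f p - fderiv ℝ f p v - (1 / 2 : ℝ) • fderiv ℝ (fderiv ℝ f) p v v)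
      =o[𝓝 0] fun v => ‖v‖ ^ 2 := by
  set H := fderiv ℝ (fderiv ℝ f) p
  have hsymm (v w : E) : H v w = H w v := hf.isSymmSndFDerivAt (by simp) v w
  have hadd : Tendsto (fun v : E => p + v) (𝓝 0) (𝓝 p) :=
    Continuous.tendsto' (by fun_prop) _ _ (add_zero p)
  have hdiff : ∀ᶠ v in 𝓝 (0 : E), DifferentiableAt ℝ f (p + v) :=
    hadd.eventually <| (hf.eventually (by simp)).mono fun z hz => hz.differentiableAt two_ne_zero
  obtain ⟨δ, hδ, hball⟩ := Metric.eventually_nhds_iff_ball.1 hdiff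
  have hderiv (v : E) (hv : v ∈ Metric.ball (0 : E) δ) : HasFDerivWithinAt
      (fun v => f (p + v) - f p - fderiv ℝ f p v - (1 / 2 : ℝ) • H v v)
      (fderiv ℝ f (p + v) - fderiv ℝ f p - H v) (Metric.ball 0 δ) v :=
    ((((hasFDerivAt_comp_add_left p).2 (hball v hv).hasFDerivAt).sub_const (f p)).sub
      (fderiv ℝ f p).hasFDerivAt |>.sub
        (hasFDerivAt_half_smul_apply_self hsymm v)).hasFDerivWithinAt
  have hfderiv : (fun v => fderiv ℝ f (p + v) - fderiv ℝ f p - H v) =o[𝓝 0] fun v => v :=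
    hasFDerivAt_iff_isLittleO_nhds_zero.1
      ((hf.fderiv_right (m := 1) le_rfl).differentiableAt one_ne_zero).hasFDerivAt
  have hball₀ : Metric.ball (0 : E) δ ∈ 𝓝 0 := Metric.ball_mem_nhds 0 hδ
  simpa [nhdsWithin_eq_nhds.2 hball₀] using
    (convex_ball (0 : E) δ).isLittleO_pow_succ (n := 1) (Metric.mem_ball_self hδ) hderiv
      (by simpa [nhdsWithin_eq_nhds.2 hball₀] using hfderiv.norm_right)

theorem isBigO_norm_sq_parabolicWeight {F : Type*} [NormedAddCommGroup F] :
    (fun z : F × ℝ => ‖z‖ ^ 2) =O[𝓝 0] parabolicWeight := by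
  refine .of_bound 1 ?_
  filter_upwards [Metric.ball_mem_nhds (0 : F × ℝ) one_pos] with z hz
  have hz₂ : |z.2| ≤ 1 := (norm_snd_le z).trans (mem_ball_zero_iff.1 hz).le
  rw [norm_parabolicWeight, norm_pow, norm_norm, one_mul, Prod.norm_def, Real.norm_eq_abs]
  rcases max_cases ‖z.1‖ |z.2| with ⟨h, -⟩ | ⟨h, -⟩ <;> rw [h] <;>
    nlinarith [abs_nonneg z.2, sq_nonneg ‖z.1‖]

variable {F : Type*} [NormedAddCommGroup F] [InnerProductSpace ℝ F]

theorem isLittleO_half_apply_self_add_norm_sq {Q : F × ℝ →L[ℝ] F × ℝ →L[ℝ] ℝ}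
    (hsymm : ∀ z w, Q z w = Q w z) (hQ : ∀ x, Q (x, 0) (x, 0) = -2 * ‖x‖ ^ 2) :
    (fun z => (1 / 2) * Q z z + ‖z.1‖ ^ 2) =o[𝓝 0] parabolicWeight := by
  have hm : Tendsto (fun z : F × ℝ => Q (z.1, 0) (0, 1) + (1 / 2) * z.2 * Q (0, 1) (0, 1))
      (𝓝 0) (𝓝 0) := by
    refine Continuous.tendsto' ?_ _ _ (by simp [Prod.mk_zero_zero])
    exact ((Q.continuous.comp (by fun_prop)).clm_apply continuous_const).add (by fun_prop)
  refine (isLittleO_snd_mul_parabolicWeight hm).congr_left fun z => ?_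
  have hz : z = (z.1, 0) + z.2 • ((0, 1) : F × ℝ) := by ext <;> simp
  have hQz : Q z z = -2 * ‖z.1‖ ^ 2 + 2 * z.2 * Q (z.1, 0) (0, 1) +
      z.2 ^ 2 * Q (0, 1) (0, 1) := by
    conv_lhs => rw [hz]
    simp only [map_add, map_smul, add_apply, smul_apply, smul_eq_mul, hQ, hsymm (0, 1) (z.1, 0)]
    ring
  rw [hQz]
  ring

theorem IsParabolicDefiningFunction.of_contDiffAt {S : Set E} {f : E → ℝ} {p : E}
    (hf : ContDiffAt ℝ 2 f p) (hS : ∀ᶠ x in 𝓝 p, x ∈ S ↔ f x = 0) (hp : p ∈ S)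
    {Φ : F × ℝ →L[ℝ] E} (hΦ : ∀ z, fderiv ℝ f p (Φ z) = z.2)
    (hΦ₂ : ∀ x, fderiv ℝ (fderiv ℝ f) p (Φ (x, 0)) (Φ (x, 0)) = -2 * ‖x‖ ^ 2) :
    IsParabolicDefiningFunction {z | p + Φ z ∈ S} fun z => f (p + Φ z) := by
  have hcont : Continuous fun z => p + Φ z := by fun_prop
  have hlim : Tendsto (fun z => p + Φ z) (𝓝 0) (𝓝 p) := hcont.tendsto' _ _ (by simp)
  have hlim₀ : Tendsto Φ (𝓝 0) (𝓝 0) := Φ.continuous.tendsto' _ _ (map_zero Φ)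
  refine ⟨hlim.eventually hS, (hlim.eventually (hf.eventually (by simp))).mono fun z hz =>
    hz.continuousAt.comp (f := fun z => p + Φ z) hcont.continuousAt, ?_⟩
  have hΦ_norm : (fun z => ‖Φ z‖ ^ 2) =O[𝓝 0] parabolicWeight :=
    ((Φ.isBigO_id _).norm_norm.pow 2).trans isBigO_norm_sq_parabolicWeight
  have htaylor := ((isLittleO_taylor_two hf).comp_tendsto hlim₀).trans_isBigO hΦ_norm
  have hquad := isLittleO_half_apply_self_add_norm_sq
    (Q := (fderiv ℝ (fderiv ℝ f) p).bilinearComp Φ Φ)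
    (fun z w => hf.isSymmSndFDerivAt (by simp) (Φ z) (Φ w)) hΦ₂
  refine (htaylor.add hquad).congr_left fun z => ?_
  simp only [Function.comp_apply, hS.self_of_nhds.1 hp, hΦ, ContinuousLinearMap.bilinearComp_apply,
    smul_eq_mul]
  ring

end SecondOrder

section AdaptedCoordinates

theorem exists_linearEquiv_apply_self_eq_norm_sq {U : Type*} [AddCommGroup U] [Module ℝ U]
    [FiniteDimensional ℝ U] {n : ℕ} (hn : Module.finrank ℝ U = n) {B : LinearMap.BilinForm ℝ U}
    (hB : B.IsSymm) (hpos : ∀ v, v ≠ 0 → 0 < B v v) :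
    ∃ ψ : EuclideanSpace ℝ (Fin n) ≃ₗ[ℝ] U, ∀ x, B (ψ x) (ψ x) = ‖x‖ ^ 2 := by
  let core : InnerProductSpace.Core ℝ U :=
    { inner := fun u v => B u v
      conj_inner_symm := fun u v => hB.eq v u
      re_inner_nonneg := fun v => by
        rcases eq_or_ne v 0 with rfl | hv
        · simp
        · exact (hpos v hv).le
      add_left := fun u v w => by simp
      smul_left := fun u v r => by simp
      definite := fun v hv => of_not_not fun h => (hpos v h).ne' hv }
  let _ : NormedAddCommGroup U := core.toNormedAddCommGroup
  let _ : InnerProductSpace ℝ U := InnerProductSpace.ofCore core.toCore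
  let ψ := ((stdOrthonormalBasis ℝ U).reindex (finCongr hn)).repr.symm
  refine ⟨ψ.toLinearEquiv, fun x => ?_⟩
  rw [← ψ.norm_map]
  exact real_inner_self_eq_norm_sq (ψ x)

theorem exists_adapted_coordinates {E : Type*} [NormedAddCommGroup E] [NormedSpace ℝ E]
    [FiniteDimensional ℝ E] {n : ℕ} (hn : Module.finrank ℝ E = n + 1) {ℓ : E →L[ℝ] ℝ} (hℓ : ℓ ≠ 0)
    {B : LinearMap.BilinForm ℝ E} (hB : B.IsSymm) (hpos : ∀ v, ℓ v = 0 → v ≠ 0 → 0 < B v v) :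
    ∃ Φ : (EuclideanSpace ℝ (Fin n) × ℝ) ≃L[ℝ] E, (∀ z, ℓ (Φ z) = z.2) ∧
      ∀ x, B (Φ (x, 0)) (Φ (x, 0)) = ‖x‖ ^ 2 := by
  have hrank : Module.finrank ℝ ℓ.ker = n := by
    have hℓ' : (ℓ : E →ₗ[ℝ] ℝ) ≠ 0 := fun h => hℓ (ContinuousLinearMap.coe_injective h)
    exact Nat.succ_injective ((Module.Dual.finrank_ker_add_one_of_ne_zero hℓ').trans hn)
  obtain ⟨ψ, hψ⟩ := exists_linearEquiv_apply_self_eq_norm_sq hrank (B := B.restrict ℓ.ker)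
    (hB.restrict _) fun v hv => hpos v v.2 (by simpa using hv)
  obtain ⟨e, he⟩ : ∃ e, ℓ e = 1 :=
    LinearMap.surjective (fun h => hℓ (ContinuousLinearMap.coe_injective h)) 1
  have hinv : Function.RightInverse (ContinuousLinearMap.toSpanSingleton ℝ e) ℓ := fun t => by
    simp [he]
  let Φ : (EuclideanSpace ℝ (Fin n) × ℝ) ≃L[ℝ] E :=
    (ContinuousLinearEquiv.prodComm ℝ _ ℝ).trans
      (((ContinuousLinearEquiv.refl ℝ ℝ).prodCongr ψ.toContinuousLinearEquiv).trans
        (ContinuousLinearEquiv.equivOfRightInverse ℓ _ hinv).symm)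
  have hΦ (z : EuclideanSpace ℝ (Fin n) × ℝ) : Φ z = z.2 • e + ψ z.1 := rfl
  refine ⟨Φ, fun z => ?_, fun x => ?_⟩
  · have hψz : ℓ (ψ z.1) = 0 := (ψ z.1).2
    simp [hΦ, he, hψz]
  · simpa [hΦ] using hψ x

end AdaptedCoordinates

section ParaboloidDefiningFunction

variable {E F : Type*} [NormedAddCommGroup E] [NormedSpace ℝ E] [NormedAddCommGroup F]
  [InnerProductSpace ℝ F]

theorem hasFDerivAt_sub_norm_sq (ℓ : E →L[ℝ] ℝ) (d : ℝ) (A : E →L[ℝ] F) (c : F) (z : E) :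
    HasFDerivAt (fun z => ℓ z + d - ‖A z + c‖ ^ 2) (ℓ - 2 • (innerSL ℝ (A z + c)).comp A) z :=
  (ℓ.hasFDerivAt.add_const d).sub (A.hasFDerivAt.add_const c).norm_sq

theorem fderiv_fderiv_sub_norm_sq_apply (ℓ : E →L[ℝ] ℝ) (d : ℝ) (A : E →L[ℝ] F) (c : F)
    (z v w : E) :
    fderiv ℝ (fderiv ℝ fun z => ℓ z + d - ‖A z + c‖ ^ 2) z v w = -2 * inner ℝ (A v) (A w) := by
  have hfderiv : (fderiv ℝ fun z => ℓ z + d - ‖A z + c‖ ^ 2) = fun z =>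
      ℓ - 2 • (innerSL ℝ c).comp A - ((2 : ℝ) • (innerSL ℝ).bilinearComp A A) z := by
    ext z w
    rw [(hasFDerivAt_sub_norm_sq ℓ d A c z).fderiv]
    simp
    ring
  rw [hfderiv, (ContinuousLinearMap.hasFDerivAt _).const_sub _ |>.fderiv]
  simp

end ParaboloidDefiningFunction

section DefiniteBoundaryPart

theorem hasDefiniteSecondFundamentalForm_sub_norm_sq {m : ℕ} {F : Type*} [NormedAddCommGroup F]
    [InnerProductSpace ℝ F] {ℓ : EuclideanSpace ℝ (Fin m) →L[ℝ] ℝ}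
    {A : EuclideanSpace ℝ (Fin m) →L[ℝ] F} (hℓA : ∀ v, ℓ v = 0 → A v = 0 → v = 0) (d : ℝ) (c : F)
    {p : EuclideanSpace ℝ (Fin m)} (hp : fderiv ℝ (fun z => ℓ z + d - ‖A z + c‖ ^ 2) p ≠ 0) :
    HasDefiniteSecondFundamentalForm (fun z => ℓ z + d - ‖A z + c‖ ^ 2) p := by
  refine .inl fun v hv hv₀ => ?_
  have hv_tangent : ℓ v - 2 * inner ℝ (A p + c) (A v) = 0 := by
    simpa [tangentHyperplane, (hasFDerivAt_sub_norm_sq ℓ d A c p).fderiv, inner_add_left,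
      mul_add] using hv
  have hAv : A v ≠ 0 := fun h => hv₀ (hℓA v (by simpa [h] using hv_tangent) h)
  rw [secondFundamentalForm, fderiv_fderiv_sub_norm_sq_apply, real_inner_self_eq_norm_sq]
  have := norm_pos_iff.2 hp
  have := norm_pos_iff.2 hAv
  rw [neg_mul, neg_neg]
  positivity

theorem definiteBoundaryPart_subset_frontier {m : ℕ} {Ω : Set (EuclideanSpace ℝ (Fin m))} :
    definiteBoundaryPart Ω ⊆ frontier Ω :=
  fun _ ⟨_, hρ, _⟩ => hρ.1

theorem definiteBoundaryPart_eq_frontier {m : ℕ} {F : Type*} [NormedAddCommGroup F]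
    [InnerProductSpace ℝ F] {Ω : Set (EuclideanSpace ℝ (Fin m))}
    (f : EuclideanSpace ℝ (Fin m) ≃ᵃ[ℝ] F × ℝ)
    (hf : ∀ z, z ∈ frontier Ω ↔ (f z).2 = ‖(f z).1‖ ^ 2) :
    definiteBoundaryPart Ω = frontier Ω := by
  refine definiteBoundaryPart_subset_frontier.antisymm fun p hp => ?_
  let L := LinearMap.toContinuousLinearMap (f.linear : EuclideanSpace ℝ (Fin m) →ₗ[ℝ] F × ℝ)
  let ℓ := (ContinuousLinearMap.snd ℝ F ℝ).comp L
  let A := (ContinuousLinearMap.fst ℝ F ℝ).comp L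
  have hf_eq (z : EuclideanSpace ℝ (Fin m)) : f z = L z + f 0 := by
    simpa [L] using f.map_vadd 0 z
  have hmem (z : EuclideanSpace ℝ (Fin m)) :
      z ∈ frontier Ω ↔ ℓ z + (f 0).2 - ‖A z + (f 0).1‖ ^ 2 = 0 := by
    rw [hf, hf_eq, sub_eq_zero]
    rfl
  have hℓA (v : EuclideanSpace ℝ (Fin m)) (hℓv : ℓ v = 0) (hAv : A v = 0) : v = 0 :=
    f.linear.map_eq_zero_iff.1 (Prod.ext hAv hℓv)
  have hne : fderiv ℝ (fun z => ℓ z + (f 0).2 - ‖A z + (f 0).1‖ ^ 2) p ≠ 0 := fun h => by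
    have hv : L (f.linear.symm (0, 1)) = (0, 1) := f.linear.apply_symm_apply (0, 1)
    rw [(hasFDerivAt_sub_norm_sq _ _ _ _ _).fderiv] at h
    simpa [ℓ, A, hv] using DFunLike.congr_fun h (f.linear.symm (0, 1))
  have hdiff : ContDiff ℝ 2 fun z => ℓ z + (f 0).2 - ‖A z + (f 0).1‖ ^ 2 :=
    (ℓ.contDiff.add contDiff_const).sub ((A.contDiff.add contDiff_const).norm_sq ℝ)
  exact ⟨_, ⟨hp, hdiff.contDiffAt, hne, .of_forall hmem⟩,
    hasDefiniteSecondFundamentalForm_sub_norm_sq hℓA _ _ hne⟩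

theorem exists_isLocalDefiningFunction_fderiv_fderiv_neg {m : ℕ}
    {Ω : Set (EuclideanSpace ℝ (Fin m))} {p : EuclideanSpace ℝ (Fin m)}
    (hp : p ∈ definiteBoundaryPart Ω) :
    ∃ ρ, IsLocalDefiningFunction (frontier Ω) p ρ ∧
      ∀ v, fderiv ℝ ρ p v = 0 → v ≠ 0 → fderiv ℝ (fderiv ℝ ρ) p v v < 0 := by
  obtain ⟨ρ, hρ, hdef⟩ := hp
  have hnorm : 0 < ‖fderiv ℝ ρ p‖ := norm_pos_iff.2 hρ.2.2.1
  rcases hdef with hpos | hneg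
  · refine ⟨ρ, hρ, fun v hv hv₀ => neg_pos.1 ?_⟩
    exact (div_pos_iff_of_pos_right hnorm).1 (hpos v hv hv₀)
  · obtain ⟨hpS, hρ_diff, hρ_ne, hρ_mem⟩ := hρ
    have hfderiv : fderiv ℝ (fun z => -ρ z) = fun z => -fderiv ℝ ρ z :=
      funext fun z => fderiv_fun_neg
    refine ⟨fun z => -ρ z, ⟨hpS, hρ_diff.neg, by simpa [hfderiv] using hρ_ne,
      by simpa using hρ_mem⟩, fun v hv hv₀ => ?_⟩
    have hv_tangent : fderiv ℝ ρ p v = 0 := by simpa [hfderiv] using hv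
    rw [hfderiv, fderiv_fun_neg]
    simpa using (div_lt_iff₀ hnorm).1 (hneg v hv_tangent hv₀)

end DefiniteBoundaryPart

section AffineCoordinates

theorem HasTransitiveAffineSymmetries.preimage {E E' : Type*} [AddCommGroup E] [Module ℝ E]
    [AddCommGroup E'] [Module ℝ E'] {Ω : Set E} (hΩ : HasTransitiveAffineSymmetries Ω)
    (τ : E' ≃ᵃ[ℝ] E) : HasTransitiveAffineSymmetries (τ ⁻¹' Ω) := by
  intro x hx y hy
  obtain ⟨g, hg, hgxy⟩ := hΩ (τ x) hx (τ y) hy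
  refine ⟨(τ.trans g).trans τ.symm, ?_, by simp [hgxy]⟩
  calc (τ.trans g).trans τ.symm '' (τ ⁻¹' Ω)
      = τ.symm '' (g '' (τ '' (τ ⁻¹' Ω))) := by simp only [image_image]; rfl
    _ = τ.symm '' Ω := by rw [image_preimage_eq _ τ.surjective, hg]
    _ = τ ⁻¹' Ω := τ.symm.toEquiv.image_eq_preimage_symm Ω

theorem isOpen_of_isOpen_tube {m : ℕ} {Ω : Set (EuclideanSpace ℝ (Fin m))} (h : IsOpen (tube Ω)) :
    IsOpen Ω := by
  have hcont : Continuous fun x : EuclideanSpace ℝ (Fin m) =>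
      (WithLp.toLp 2 (fun i => (x i : ℂ)) : EuclideanSpace ℂ (Fin m)) :=
    (PiLp.continuous_toLp 2 _).comp (by fun_prop)
  exact h.preimage hcont

theorem exists_coordinates_isParabolicDefiningFunction {n : ℕ}
    {Ω : Set (EuclideanSpace ℝ (Fin (n + 1)))} {p : EuclideanSpace ℝ (Fin (n + 1))}
    (hp : p ∈ definiteBoundaryPart Ω) :
    ∃ (Φ : (EuclideanSpace ℝ (Fin n) × ℝ) ≃L[ℝ] EuclideanSpace ℝ (Fin (n + 1)))
      (ρ : EuclideanSpace ℝ (Fin n) × ℝ → ℝ),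
      IsParabolicDefiningFunction {z | p + Φ z ∈ frontier Ω} ρ ∧
        HasStrictFDerivAt ρ (ContinuousLinearMap.snd ℝ (EuclideanSpace ℝ (Fin n)) ℝ) 0 := by
  obtain ⟨ρ, ⟨hpΩ, hρ, hρ_ne, hρ_mem⟩, hneg⟩ := exists_isLocalDefiningFunction_fderiv_fderiv_neg hp
  let B : LinearMap.BilinForm ℝ (EuclideanSpace ℝ (Fin (n + 1))) :=
    -(1 / 2 : ℝ) • (fderiv ℝ (fderiv ℝ ρ) p).toBilinForm
  have hB_apply (v w : EuclideanSpace ℝ (Fin (n + 1))) :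
      B v w = -(1 / 2) * fderiv ℝ (fderiv ℝ ρ) p v w := by simp [B]
  have hB : B.IsSymm := ⟨fun v w => by
    simp only [hB_apply, hρ.isSymmSndFDerivAt (by simp) v w]⟩
  obtain ⟨Φ, hΦ, hΦ₂⟩ := exists_adapted_coordinates (n := n) (by simp) hρ_ne hB fun v hv hv₀ => by
    linarith [hB_apply v v, hneg v hv hv₀]
  refine ⟨Φ, fun z => ρ (p + Φ z), .of_contDiffAt hρ hρ_mem hpΩ
    (Φ := Φ.toContinuousLinearMap) hΦ fun x => ?_, ?_⟩
  · have := hΦ₂ x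
    rw [hB_apply] at this
    rw [ContinuousLinearEquiv.coe_coe]
    linarith
  · have hρ_strict : HasStrictFDerivAt ρ (fderiv ℝ ρ p) (p + Φ 0) := by
      simpa using hρ.hasStrictFDerivAt two_ne_zero
    exact (hρ_strict.comp 0 (Φ.hasStrictFDerivAt.const_add p)).congr_fderiv
      (ContinuousLinearMap.ext hΦ)

theorem exists_affineEquiv_mem_frontier_iff {n : ℕ} (hn : 1 ≤ n)
    {Ω : Set (EuclideanSpace ℝ (Fin (n + 1)))} (hΩ : IsOpen Ω)
    (hΩ_hom : HasTransitiveAffineSymmetries Ω) (hne : (definiteBoundaryPart Ω).Nonempty) :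
    ∃ f : EuclideanSpace ℝ (Fin (n + 1)) ≃ᵃ[ℝ] EuclideanSpace ℝ (Fin n) × ℝ,
      ∀ z, z ∈ frontier Ω ↔ (f z).2 = ‖(f z).1‖ ^ 2 := by
  have : Nonempty (Fin n) := ⟨⟨0, hn⟩⟩
  obtain ⟨p, hp⟩ := hne
  obtain ⟨Φ, ρ, hpar, hρ⟩ := exists_coordinates_isParabolicDefiningFunction hp
  let τ : (EuclideanSpace ℝ (Fin n) × ℝ) ≃ᵃ[ℝ] EuclideanSpace ℝ (Fin (n + 1)) :=
    Φ.toLinearEquiv.toAffineEquiv.trans (AffineEquiv.constVAdd ℝ _ p)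
  let τ_homeo := Φ.toHomeomorph.trans (Homeomorph.addLeft p)
  have hfrontier : τ ⁻¹' frontier Ω = frontier (τ ⁻¹' Ω) := τ_homeo.preimage_frontier Ω
  have h₀ : 0 ∈ frontier (τ ⁻¹' Ω) := by
    rw [← hfrontier]
    simpa [τ] using definiteBoundaryPart_subset_frontier hp
  obtain ⟨b, hb⟩ := frontier_eq_paraboloid (Ω := τ ⁻¹' Ω) (τ_homeo.continuous.isOpen_preimage _ hΩ)
    (hΩ_hom.preimage τ) h₀ (hfrontier ▸ hpar) hρ
  let σ : (EuclideanSpace ℝ (Fin n) × ℝ) ≃ₗ[ℝ] EuclideanSpace ℝ (Fin n) × ℝ :=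
    LinearEquiv.prodComm ℝ _ ℝ ≪≫ₗ (LinearEquiv.refl ℝ ℝ).skewProd (LinearEquiv.refl ℝ _)
      (-LinearMap.toSpanSingleton ℝ _ b) ≪≫ₗ LinearEquiv.prodComm ℝ ℝ _
  have hσ (z : EuclideanSpace ℝ (Fin n) × ℝ) : σ z = (z.1 - z.2 • b, z.2) := by
    simp [σ, sub_eq_add_neg]
  refine ⟨τ.symm.trans σ.toAffineEquiv, fun z => ?_⟩
  calc z ∈ frontier Ω ↔ τ.symm z ∈ τ ⁻¹' frontier Ω := by simp
    _ ↔ _ := by rw [hfrontier, hb]; simp [hσ]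

/-- Splitting off the last coordinate of `ℝ^{n+1}`. -/
def euclideanInitLast (n : ℕ) :
    EuclideanSpace ℝ (Fin (n + 1)) ≃ₗ[ℝ] EuclideanSpace ℝ (Fin n) × ℝ where
  toFun v := (WithLp.toLp 2 fun i => v i.castSucc, v (Fin.last n))
  invFun z := WithLp.toLp 2 (Fin.snoc (α := fun _ => ℝ) z.1 z.2)
  map_add' _ _ := rfl
  map_smul' _ _ := rfl
  left_inv v := by ext i; refine Fin.lastCases ?_ (fun i => ?_) i <;> simp
  right_inv z := by ext <;> simp

theorem mem_paraboloid_iff {n : ℕ} {v : EuclideanSpace ℝ (Fin (n + 1))} :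
    v ∈ paraboloid n ↔ (euclideanInitLast n v).2 = ‖(euclideanInitLast n v).1‖ ^ 2 := by
  rw [EuclideanSpace.real_norm_sq_eq]
  rfl

end AffineCoordinates

theorem theorem1_general (n : ℕ) (hn : 1 ≤ n) (Ω : Set (EuclideanSpace ℝ (Fin (n + 1))))
    (hΩ_open : IsOpen Ω) (hΩ : IsAffinelyHomogeneous Ω) (hne : (definiteBoundaryPart Ω).Nonempty) :
    ∃ f : EuclideanSpace ℝ (Fin (n + 1)) ≃ᵃ[ℝ] EuclideanSpace ℝ (Fin (n + 1)),
      f '' definiteBoundaryPart Ω = paraboloid n := by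
  obtain ⟨f, hf⟩ := exists_affineEquiv_mem_frontier_iff hn hΩ_open hΩ hne
  let g := f.trans (euclideanInitLast n).symm.toAffineEquiv
  have hg : frontier Ω = g ⁻¹' paraboloid n :=
    Set.ext fun z => (hf z).trans (by simp [g, mem_paraboloid_iff])
  exact ⟨g, by rw [definiteBoundaryPart_eq_frontier f hf, hg, image_preimage_eq _ g.surjective]⟩

theorem theorem1 (n : ℕ) (hn : 1 ≤ n)
    (D : Set (EuclideanSpace ℂ (Fin (n + 1)))) (hD_open : IsOpen D) (hD_conn : IsConnected D)
    (Ω : Set (EuclideanSpace ℝ (Fin (n + 1)))) (hD : D = tube Ω)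
    (hΩ : IsAffinelyHomogeneous Ω)
    (Γ : Set (EuclideanSpace ℝ (Fin (n + 1)))) (hΓ_ne : Γ.Nonempty)
    (hΓ_open : ∃ U : Set (EuclideanSpace ℝ (Fin (n + 1))), IsOpen U ∧ Γ = U ∩ frontier Ω)
    (hΓ_def : Γ ⊆ definiteBoundaryPart Ω)
    (hΓ_trans : ActsLocallyTransitivelyOn Ω Γ) :
    ∃ f : EuclideanSpace ℝ (Fin (n + 1)) ≃ᵃ[ℝ] EuclideanSpace ℝ (Fin (n + 1)),
      f '' definiteBoundaryPart Ω = paraboloid n :=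
  theorem1_general n hn Ω (isOpen_of_isOpen_tube (hD ▸ hD_open)) hΩ (hΓ_ne.mono hΓ_def)
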